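/- Let $\Omega\subset\mathbb R^2$ be a bounded simply connected domain with smooth boundary, let $\nu=(\nu_1,\nu_2,0)$ be the outward normal to $\partial\Omega$, let $k\in\mathbb R$ and let $l\ge 1$ be an integer. Let $\mathcal DH^l(\Omega)$ be the space of all $\Phi=(\varphi,\alpha,\psi,\beta)$ with $\varphi,\psi\in H^l(\Omega;\mathbb C^3)$ and $\alpha,\beta\in H^l(\Omega;\mathbb C)$ such that $\nu\times\varphi=0$, $\langle\psi,\nu\rangle=0$ and $\beta=0$ on $\partial\Omega$ (in the sense of traces). For $\lambda\in\mathbb C$ let $\nabla(\lambda)$, $\mathrm{rot}(\lambda)$, $\mathrm{div}(\lambda)$ be the usual three-dimensional operations with $\partial_3$ replaced by multiplication by $i\lambda$. Define on $\mathcal DH^l(\Omega)$ the elliptic pencil $$ \mathfrak A(\lambda,k)(\varphi,\alpha,\psi,\beta)=\bigl(i\,\mathrm{rot}(\lambda)\psi+i\nabla(\lambda)\beta-k\varphi,\ -i\,\mathrm{div}(\lambda)\psi-k\alpha,\ -i\,\mathrm{rot}(\lambda)\varphi-i\nabla(\lambda)\alpha-k\psi,\ i\,\mathrm{div}(\lambda)\varphi-k\beta\bigr),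 $$ and let the Maxwell pencil $\mathfrak M(\lambda,k)$ be the restriction of $\mathfrak A(\lambda,k)$ to the vectors $(\varphi,0,\psi,0)\in\mathcal DH^l(\Omega)$. A number $\lambda$ is an eigenvalue of a pencil, and $\Phi\ne0$ in its domain a corresponding eigenvector, if the pencil at $\lambda$ annihilates $\Phi$; the eigenspace consists of all $\Phi$ annihilated. Then: 1. If $\lambda\in\mathbb C$ and $\lambda^2=k^2\neq0$, then $\lambda$ is an eigenvalue of $\mathfrak A(\cdot,k)$, and its eigenspace is one-dimensional and spanned by the vector $\Phi$ with $\varphi=0$, $\alpha=\mathrm{const}\neq0$, $\psi=(0,0,(\lambda/k)\alpha)$, $\beta=0$. The vector $\Phi$ does not belong to the domain of $\mathfrak M(\cdot,k)$, and $\lambda$ is not an eigenvalue of $\mathfrak M(\cdot,k)$. 2. If $k=0$, then $\lambda=0$ is an eigenvalue of $\mathfrak A(\cdot,k)$ with two-dimensional eigenspace spanned by $\widehat\Phi=(0,\hat\alpha,0,0)$ and $\widetilde\Phi=(0,0,(0,0,\tilde\psi_3),0)$, where $\hat\alpha$ and $\tilde\psi_3$ are nonzero constants. The vector $\widehat\Phi$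 does not belong to the domain of $\mathfrak M(\cdot,k)$, while $\widetilde\Phi$ is an eigenvector of $\mathfrak M(\cdot,k)$ for $\lambda=0$. -/

import Mathlib

open MeasureTheory
open scoped ContDiff

noncomputable section

namespace Waveguide

/-- The plane `ℝ²` with its Euclidean structure. -/
abbrev Plane : Type := EuclideanSpace ℝ (Fin 2)

/-- The boundary of `U` is smooth: near each of its boundary points, in suitable Cartesian
coordinates, `U` is the part of the plane lying below the graph of a smooth function. -/
def HasSmoothBoundary (U : Set Plane) : Prop :=
  ∀ p ∈ frontier U, ∃ (e : Plane ≃ᵃⁱ[ℝ] Plane) (γ : ℝ → ℝ) (r : ℝ),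
    ContDiff ℝ ∞ γ ∧ 0 < r ∧ ∀ x ∈ Metric.ball p r, (x ∈ U ↔ e x 1 < γ (e x 0))

/-- A bounded domain in the plane with smooth boundary. -/
structure PlanarDomain where
  /-- the underlying set -/
  carrier : Set Plane
  isOpen : IsOpen carrier
  isConnected : IsConnected carrier
  isBounded : Bornology.IsBounded carrier
  hasSmoothBoundary : HasSmoothBoundary carrier

/-- Lebesgue measure on `Ω`. -/
abbrev PlanarDomain.vol (Ω : PlanarDomain) : Measure Plane := volume.restrict Ω.carrier

instance (Ω : PlanarDomain) : IsFiniteMeasure Ω.vol :=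
  ⟨by simpa using Ω.isBounded.measure_lt_top⟩

/-- The complex Hilbert space `L²(Ω)`. -/
abbrev L2 (Ω : PlanarDomain) : Type := Lp ℂ 2 Ω.vol

/-- The classical partial derivative `∂_j η` of a real function in the plane. -/
def partialDeriv (j : Fin 2) (η : Plane → ℝ) (x : Plane) : ℝ :=
  fderiv ℝ η x (EuclideanSpace.single j 1)

/-- `v` is the weak partial derivative `∂_j u` in `Ω`. -/
def HasWeakPartial (Ω : PlanarDomain) (j : Fin 2) (u v : L2 Ω) : Prop :=
  ∀ η : Plane → ℝ, ContDiff ℝ ∞ η → HasCompactSupport η → tsupport η ⊆ Ω.carrier →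
    ∫ x, partialDeriv j η x • u x ∂Ω.vol = -∫ x, η x • v x ∂Ω.vol

lemma integrable_test (Ω : PlanarDomain) {η : Plane → ℝ} (hη : Continuous η)
    (hc : HasCompactSupport η) (u : L2 Ω) : Integrable (fun x => η x • u x) Ω.vol := by
  have hu : Integrable u Ω.vol := (Lp.memLp u).integrable (by norm_num)
  obtain ⟨C, hC⟩ := hc.exists_bound_of_continuous hη
  exact hu.bdd_smul C hη.aestronglyMeasurable (Filter.Eventually.of_forall hC)

lemma continuous_partialDeriv (j : Fin 2) {η : Plane → ℝ} (hη : ContDiff ℝ ∞ η) :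
    Continuous (partialDeriv j η) :=
  (hη.continuous_fderiv (by simp)).clm_apply continuous_const

lemma hasCompactSupport_partialDeriv (j : Fin 2) {η : Plane → ℝ} (hc : HasCompactSupport η) :
    HasCompactSupport (partialDeriv j η) :=
  hc.fderiv_apply (𝕜 := ℝ) _

lemma integral_test_add (Ω : PlanarDomain) {η : Plane → ℝ} (hη : Continuous η)
    (hc : HasCompactSupport η) (u v : L2 Ω) :
    ∫ x, η x • (u + v : L2 Ω) x ∂Ω.vol
      = ∫ x, η x • u x ∂Ω.vol + ∫ x, η x • v x ∂Ω.vol := by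
  rw [← integral_add (integrable_test Ω hη hc u) (integrable_test Ω hη hc v)]
  refine integral_congr_ae ?_
  filter_upwards [Lp.coeFn_add u v] with x hx
  simp only [hx, Pi.add_apply, smul_add]

lemma integral_test_smul (Ω : PlanarDomain) (η : Plane → ℝ) (c : ℂ) (u : L2 Ω) :
    ∫ x, η x • (c • u : L2 Ω) x ∂Ω.vol = c * ∫ x, η x • u x ∂Ω.vol := by
  rw [← integral_const_mul]
  refine integral_congr_ae ?_
  filter_upwards [Lp.coeFn_smul c u] with x hx
  simp only [hx, Pi.smul_apply, smul_eq_mul, Complex.real_smul]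
  ring

lemma integral_test_zero (Ω : PlanarDomain) (η : Plane → ℝ) :
    ∫ x, η x • (0 : L2 Ω) x ∂Ω.vol = 0 := by
  simpa using integral_test_smul Ω η 0 0

lemma HasWeakPartial.add {Ω : PlanarDomain} {j : Fin 2} {u u' v v' : L2 Ω}
    (h : HasWeakPartial Ω j u v) (h' : HasWeakPartial Ω j u' v') :
    HasWeakPartial Ω j (u + u') (v + v') := fun η hη hc hs => by
  rw [integral_test_add Ω (continuous_partialDeriv j hη) (hasCompactSupport_partialDeriv j hc),
    integral_test_add Ω hη.continuous hc, h η hη hc hs, h' η hη hc hs]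
  ring

lemma HasWeakPartial.smul {Ω : PlanarDomain} {j : Fin 2} {u v : L2 Ω} (c : ℂ)
    (h : HasWeakPartial Ω j u v) : HasWeakPartial Ω j (c • u) (c • v) := fun η hη hc hs => by
  rw [integral_test_smul, integral_test_smul, h η hη hc hs]
  ring

lemma HasWeakPartial.zero (Ω : PlanarDomain) (j : Fin 2) : HasWeakPartial Ω j 0 0 :=
  fun η _ _ _ => by rw [integral_test_zero, integral_test_zero, neg_zero]

lemma HasWeakPartial.unique {Ω : PlanarDomain} {j : Fin 2} {u v w : L2 Ω}
    (hv : HasWeakPartial Ω j u v) (hw : HasWeakPartial Ω j u w) : v = w := by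
  have h0 : HasWeakPartial Ω j 0 (v - w) := by
    simpa [sub_eq_add_neg] using hv.add (hw.smul (-1))
  have hae : ∀ᵐ x ∂(volume : Measure Plane), x ∈ Ω.carrier → (v - w : L2 Ω) x = 0 := by
    refine Ω.isOpen.ae_eq_zero_of_integral_contDiff_smul_eq_zero ?_ ?_
    · have hi : IntegrableOn (v - w : L2 Ω) Ω.carrier volume :=
        (Lp.memLp (v - w)).integrable (by norm_num)
      exact hi.locallyIntegrableOn
    · intro η hη hc hs
      have h1 := h0 η hη hc hs
      rw [integral_test_zero] at h1
      have h2 : ∫ x in Ω.carrier, η x • (v - w : L2 Ω) x = ∫ x, η x • (v - w : L2 Ω) x := by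
        refine setIntegral_eq_integral_of_forall_compl_eq_zero fun x hx => ?_
        rw [image_eq_zero_of_notMem_tsupport fun hx' => hx (hs hx'), zero_smul]
      rw [← h2]
      exact (neg_eq_zero.mp h1.symm)
  have : (v - w : L2 Ω) = 0 := by
    rw [Lp.eq_zero_iff_ae_eq_zero]
    exact (ae_restrict_iff' Ω.isOpen.measurableSet).mpr hae
  exact sub_eq_zero.mp this

/-- The Sobolev space `H^l(Ω)`: all weak derivatives of order at most `l` are in `L²(Ω)`. -/
def sobolev (Ω : PlanarDomain) : ℕ → Submodule ℂ (L2 Ω)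
  | 0 => ⊤
  | l + 1 =>
    { carrier := {u | ∀ j, ∃ v ∈ sobolev Ω l, HasWeakPartial Ω j u v}
      add_mem' := fun {u u'} hu hu' j => by
        obtain ⟨v, hv, h⟩ := hu j
        obtain ⟨v', hv', h'⟩ := hu' j
        exact ⟨v + v', add_mem hv hv', h.add h'⟩
      zero_mem' := fun j => ⟨0, zero_mem _, HasWeakPartial.zero Ω j⟩
      smul_mem' := fun c u hu j => by
        obtain ⟨v, hv, h⟩ := hu j
        exact ⟨c • v, Submodule.smul_mem _ c hv, h.smul c⟩ }

open Classical in
/-- The weak derivative `∂_j u` of `u ∈ H¹(Ω)` (with the value `0` if it does not exist). -/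
def weakPartial (Ω : PlanarDomain) (j : Fin 2) (u : L2 Ω) : L2 Ω :=
  if h : ∃ v, HasWeakPartial Ω j u v then h.choose else 0

lemma HasWeakPartial.weakPartial_eq {Ω : PlanarDomain} {j : Fin 2} {u v : L2 Ω}
    (h : HasWeakPartial Ω j u v) : weakPartial Ω j u = v := by
  have hex : ∃ v, HasWeakPartial Ω j u v := ⟨v, h⟩
  rw [weakPartial, dif_pos hex]
  exact hex.choose_spec.unique h

lemma hasWeakPartial_of_mem {Ω : PlanarDomain} {l : ℕ+} {u : L2 Ω} (hu : u ∈ sobolev Ω l)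
    (j : Fin 2) : HasWeakPartial Ω j u (weakPartial Ω j u) := by
  obtain ⟨m, hm⟩ := Nat.exists_eq_succ_of_ne_zero l.ne_zero
  rw [hm] at hu
  obtain ⟨v, -, h⟩ := hu j
  rw [h.weakPartial_eq]
  exact h

lemma weakPartial_add {Ω : PlanarDomain} {l : ℕ+} {u v : L2 Ω} (hu : u ∈ sobolev Ω l)
    (hv : v ∈ sobolev Ω l) (j : Fin 2) :
    weakPartial Ω j (u + v) = weakPartial Ω j u + weakPartial Ω j v :=
  ((hasWeakPartial_of_mem hu j).add (hasWeakPartial_of_mem hv j)).weakPartial_eq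

lemma weakPartial_smul {Ω : PlanarDomain} {l : ℕ+} {u : L2 Ω} (c : ℂ) (hu : u ∈ sobolev Ω l)
    (j : Fin 2) : weakPartial Ω j (c • u) = c • weakPartial Ω j u :=
  ((hasWeakPartial_of_mem hu j).smul c).weakPartial_eq

lemma weakPartial_zero (Ω : PlanarDomain) (j : Fin 2) : weakPartial Ω j 0 = 0 :=
  (HasWeakPartial.zero Ω j).weakPartial_eq

/-- By Gauss's theorem `∫_Ω ∂_j (u η) dx = ∫_∂Ω ν_j u η ds`, so this is the boundary
distribution `ν_j u|∂Ω` (`ν` the outward unit normal, `u ∈ H¹(Ω)`) applied to `η`. -/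
def boundaryPairing (Ω : PlanarDomain) (j : Fin 2) (u : L2 Ω) (η : Plane → ℝ) : ℂ :=
  ∫ x, η x • weakPartial Ω j u x ∂Ω.vol + ∫ x, partialDeriv j η x • u x ∂Ω.vol

lemma boundaryPairing_add {Ω : PlanarDomain} {l : ℕ+} {u v : L2 Ω} (hu : u ∈ sobolev Ω l)
    (hv : v ∈ sobolev Ω l) (j : Fin 2) {η : Plane → ℝ} (hη : ContDiff ℝ ∞ η)
    (hc : HasCompactSupport η) : boundaryPairing Ω j (u + v) η
      = boundaryPairing Ω j u η + boundaryPairing Ω j v η := by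
  rw [boundaryPairing, weakPartial_add hu hv, integral_test_add Ω hη.continuous hc,
    integral_test_add Ω (continuous_partialDeriv j hη) (hasCompactSupport_partialDeriv j hc)]
  simp only [boundaryPairing]
  ring

lemma boundaryPairing_smul {Ω : PlanarDomain} {l : ℕ+} {u : L2 Ω} (c : ℂ)
    (hu : u ∈ sobolev Ω l) (j : Fin 2) (η : Plane → ℝ) :
    boundaryPairing Ω j (c • u) η = c * boundaryPairing Ω j u η := by
  rw [boundaryPairing, weakPartial_smul c hu, integral_test_smul, integral_test_smul,
    boundaryPairing]
  ring

lemma boundaryPairing_zero (Ω : PlanarDomain) (j : Fin 2) (η : Plane → ℝ) :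
    boundaryPairing Ω j 0 η = 0 := by
  rw [boundaryPairing, weakPartial_zero, integral_test_zero, integral_test_zero, add_zero]

/-- `φ_τ = 0` on `∂Ω`: the components `(ν₂ φ₃, -ν₁ φ₃, ν₁ φ₂ - ν₂ φ₁)` of `ν × φ`,
`ν = (ν₁, ν₂, 0)`, vanish. -/
def TangentialZero (Ω : PlanarDomain) (φ : Fin 3 → L2 Ω) : Prop :=
  ∀ η : Plane → ℝ, ContDiff ℝ ∞ η → HasCompactSupport η →
    boundaryPairing Ω 1 (φ 2) η = 0 ∧ boundaryPairing Ω 0 (φ 2) η = 0 ∧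
      boundaryPairing Ω 0 (φ 1) η - boundaryPairing Ω 1 (φ 0) η = 0

/-- `ψ_ν = 0` on `∂Ω`: the scalar product `⟨ψ, ν⟩ = ν₁ ψ₁ + ν₂ ψ₂` vanishes. -/
def NormalZero (Ω : PlanarDomain) (ψ : Fin 3 → L2 Ω) : Prop :=
  ∀ η : Plane → ℝ, ContDiff ℝ ∞ η → HasCompactSupport η →
    boundaryPairing Ω 0 (ψ 0) η + boundaryPairing Ω 1 (ψ 1) η = 0

/-- `β = 0` on `∂Ω`: both `ν₁ β` and `ν₂ β` vanish. -/
def TraceZero (Ω : PlanarDomain) (β : L2 Ω) : Prop :=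
  ∀ η : Plane → ℝ, ContDiff ℝ ∞ η → HasCompactSupport η →
    ∀ j, boundaryPairing Ω j β η = 0

/-- The space `L²(Ω; ℂ⁸)` of vectors `Φ = (φ, α, ψ, β)`. -/
abbrev Field8 (Ω : PlanarDomain) : Type :=
  (Fin 3 → L2 Ω) × L2 Ω × (Fin 3 → L2 Ω) × L2 Ω

/-- The space `𝒟H^l(Ω)`, `l = 1, 2, …`, of vectors `(φ, α, ψ, β) ∈ H^l(Ω; ℂ⁸)` with
`φ_τ = 0`, `ψ_ν = 0`, `β = 0` on `∂Ω`. -/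
def DH (Ω : PlanarDomain) (l : ℕ+) : Submodule ℂ (Field8 Ω) where
  carrier := {Φ | (∀ i, Φ.1 i ∈ sobolev Ω l) ∧ Φ.2.1 ∈ sobolev Ω l ∧
    (∀ i, Φ.2.2.1 i ∈ sobolev Ω l) ∧ Φ.2.2.2 ∈ sobolev Ω l ∧
    TangentialZero Ω Φ.1 ∧ NormalZero Ω Φ.2.2.1 ∧ TraceZero Ω Φ.2.2.2}
  add_mem' := by
    rintro ⟨φ, α, ψ, β⟩ ⟨φ', α', ψ', β'⟩ ⟨h1, h2, h3, h4, h5, h6, h7⟩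
      ⟨h1', h2', h3', h4', h5', h6', h7'⟩
    refine ⟨fun i => add_mem (h1 i) (h1' i), add_mem h2 h2', fun i => add_mem (h3 i) (h3' i),
      add_mem h4 h4', fun η hη hc => ?_, fun η hη hc => ?_, fun η hη hc j => ?_⟩
    · obtain ⟨a, b, c⟩ := h5 η hη hc
      obtain ⟨a', b', c'⟩ := h5' η hη hc
      simp only [Prod.mk_add_mk, Pi.add_apply] at *
      simp only [boundaryPairing_add (h1 _) (h1' _) _ hη hc]
      refine ⟨by rw [a, a', add_zero], by rw [b, b', add_zero], ?_⟩
      linear_combination c + c'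
    · have a := h6 η hη hc
      have a' := h6' η hη hc
      simp only [Prod.mk_add_mk, Pi.add_apply] at *
      simp only [boundaryPairing_add (h3 _) (h3' _) _ hη hc]
      linear_combination a + a'
    · have a := h7 η hη hc j
      have a' := h7' η hη hc j
      simp only [Prod.mk_add_mk] at *
      rw [boundaryPairing_add h4 h4' _ hη hc, a, a', add_zero]
  zero_mem' := by
    refine ⟨fun i => zero_mem _, zero_mem _, fun i => zero_mem _, zero_mem _,
      fun η _ _ => ?_, fun η _ _ => ?_, fun η _ _ j => ?_⟩ <;>
    simp [boundaryPairing_zero]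
  smul_mem' := by
    rintro s ⟨φ, α, ψ, β⟩ ⟨h1, h2, h3, h4, h5, h6, h7⟩
    refine ⟨fun i => Submodule.smul_mem _ s (h1 i), Submodule.smul_mem _ s h2,
      fun i => Submodule.smul_mem _ s (h3 i), Submodule.smul_mem _ s h4,
      fun η hη hc => ?_, fun η hη hc => ?_, fun η hη hc j => ?_⟩
    · obtain ⟨a, b, c⟩ := h5 η hη hc
      simp only [Prod.smul_mk, Pi.smul_apply] at *
      simp only [boundaryPairing_smul s (h1 _)]
      refine ⟨by rw [a, mul_zero], by rw [b, mul_zero], ?_⟩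
      linear_combination s * c
    · have a := h6 η hη hc
      simp only [Prod.smul_mk, Pi.smul_apply] at *
      simp only [boundaryPairing_smul s (h3 _)]
      linear_combination s * a
    · have a := h7 η hη hc j
      simp only [Prod.smul_mk] at *
      rw [boundaryPairing_smul s h4, a, mul_zero]

/-- `exp(-i ev x₃) ∂_j (exp(i ev x₃) u(x₁, x₂))`, `j = 1, 2, 3`: the first two are the partial
derivatives of `u`, the third one is `i ev u`. -/
def pencilPartial (Ω : PlanarDomain) (ev : ℂ) (j : Fin 3) (u : L2 Ω) : L2 Ω :=
  ![weakPartial Ω 0 u, weakPartial Ω 1 u, (Complex.I * ev) • u] j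

/-- `∇(ev) u`. -/
def pencilGrad (Ω : PlanarDomain) (ev : ℂ) (u : L2 Ω) : Fin 3 → L2 Ω :=
  fun j => pencilPartial Ω ev j u

/-- `div(ev) φ`. -/
def pencilDiv (Ω : PlanarDomain) (ev : ℂ) (φ : Fin 3 → L2 Ω) : L2 Ω :=
  ∑ j, pencilPartial Ω ev j (φ j)

/-- `rot(ev) φ`. -/
def pencilRot (Ω : PlanarDomain) (ev : ℂ) (φ : Fin 3 → L2 Ω) : Fin 3 → L2 Ω :=
  ![pencilPartial Ω ev 1 (φ 2) - pencilPartial Ω ev 2 (φ 1),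
    pencilPartial Ω ev 2 (φ 0) - pencilPartial Ω ev 0 (φ 2),
    pencilPartial Ω ev 0 (φ 1) - pencilPartial Ω ev 1 (φ 0)]

lemma pencilPartial_add {Ω : PlanarDomain} {l : ℕ+} (ev : ℂ) {u v : L2 Ω}
    (hu : u ∈ sobolev Ω l) (hv : v ∈ sobolev Ω l) (j : Fin 3) :
    pencilPartial Ω ev j (u + v) = pencilPartial Ω ev j u + pencilPartial Ω ev j v := by
  fin_cases j <;> simp [pencilPartial, weakPartial_add hu hv]

lemma pencilPartial_smul {Ω : PlanarDomain} {l : ℕ+} (ev c : ℂ) {u : L2 Ω}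
    (hu : u ∈ sobolev Ω l) (j : Fin 3) :
    pencilPartial Ω ev j (c • u) = c • pencilPartial Ω ev j u := by
  fin_cases j <;> simp [pencilPartial, weakPartial_smul c hu, smul_smul, mul_comm]

lemma pencilGrad_add {Ω : PlanarDomain} {l : ℕ+} (ev : ℂ) {u v : L2 Ω}
    (hu : u ∈ sobolev Ω l) (hv : v ∈ sobolev Ω l) :
    pencilGrad Ω ev (u + v) = pencilGrad Ω ev u + pencilGrad Ω ev v :=
  funext fun j => pencilPartial_add ev hu hv j

lemma pencilGrad_smul {Ω : PlanarDomain} {l : ℕ+} (ev c : ℂ) {u : L2 Ω}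
    (hu : u ∈ sobolev Ω l) : pencilGrad Ω ev (c • u) = c • pencilGrad Ω ev u :=
  funext fun j => pencilPartial_smul ev c hu j

lemma pencilDiv_add {Ω : PlanarDomain} {l : ℕ+} (ev : ℂ) {φ ψ : Fin 3 → L2 Ω}
    (hφ : ∀ i, φ i ∈ sobolev Ω l) (hψ : ∀ i, ψ i ∈ sobolev Ω l) :
    pencilDiv Ω ev (φ + ψ) = pencilDiv Ω ev φ + pencilDiv Ω ev ψ := by
  simp only [pencilDiv, Pi.add_apply, pencilPartial_add ev (hφ _) (hψ _),
    Finset.sum_add_distrib]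

lemma pencilDiv_smul {Ω : PlanarDomain} {l : ℕ+} (ev c : ℂ) {φ : Fin 3 → L2 Ω}
    (hφ : ∀ i, φ i ∈ sobolev Ω l) : pencilDiv Ω ev (c • φ) = c • pencilDiv Ω ev φ := by
  simp only [pencilDiv, Pi.smul_apply, pencilPartial_smul ev c (hφ _), Finset.smul_sum]

lemma pencilRot_add {Ω : PlanarDomain} {l : ℕ+} (ev : ℂ) {φ ψ : Fin 3 → L2 Ω}
    (hφ : ∀ i, φ i ∈ sobolev Ω l) (hψ : ∀ i, ψ i ∈ sobolev Ω l) :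
    pencilRot Ω ev (φ + ψ) = pencilRot Ω ev φ + pencilRot Ω ev ψ := by
  simp only [pencilRot, Pi.add_apply, pencilPartial_add ev (hφ _) (hψ _)]
  funext j
  fin_cases j <;> simp <;> abel

lemma pencilRot_smul {Ω : PlanarDomain} {l : ℕ+} (ev c : ℂ) {φ : Fin 3 → L2 Ω}
    (hφ : ∀ i, φ i ∈ sobolev Ω l) : pencilRot Ω ev (c • φ) = c • pencilRot Ω ev φ := by
  simp only [pencilRot, Pi.smul_apply, pencilPartial_smul ev c (hφ _)]
  funext j
  fin_cases j <;> simp [smul_sub]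

/-- The right-hand side of the augmented Maxwell pencil applied to `(φ, α, ψ, β)`:
`(i rot(ev) ψ + i ∇(ev) β - k φ, -i div(ev) ψ - k α, -i rot(ev) φ - i ∇(ev) α - k ψ,
i div(ev) φ - k β)`. -/
def pencilFun (Ω : PlanarDomain) (k : ℝ) (ev : ℂ) (Φ : Field8 Ω) : Field8 Ω :=
  let φ := Φ.1
  let α := Φ.2.1
  let ψ := Φ.2.2.1
  let β := Φ.2.2.2
  (Complex.I • pencilRot Ω ev ψ + Complex.I • pencilGrad Ω ev β - (k : ℂ) • φ,
    -(Complex.I • pencilDiv Ω ev ψ) - (k : ℂ) • α,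
    -(Complex.I • pencilRot Ω ev φ) - Complex.I • pencilGrad Ω ev α - (k : ℂ) • ψ,
    Complex.I • pencilDiv Ω ev φ - (k : ℂ) • β)

/-- The elliptic pencil `ev ↦ 𝔄(ev, k)` on the domain `𝒟H^l(Ω)`. -/
def pencilA (Ω : PlanarDomain) (l : ℕ+) (k : ℝ) (ev : ℂ) : DH Ω l →ₗ[ℂ] Field8 Ω where
  toFun Φ := pencilFun Ω k ev Φ
  map_add' := by
    rintro ⟨⟨φ, α, ψ, β⟩, h1, h2, h3, h4, -⟩ ⟨⟨φ', α', ψ', β'⟩, h1', h2', h3', h4', -⟩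
    simp only [pencilFun, Submodule.coe_add, Prod.fst_add, Prod.snd_add,
      pencilRot_add ev h3 h3', pencilRot_add ev h1 h1', pencilDiv_add ev h3 h3',
      pencilDiv_add ev h1 h1', pencilGrad_add ev h2 h2', pencilGrad_add ev h4 h4', smul_add]
    refine Prod.ext ?_ (Prod.ext ?_ (Prod.ext ?_ ?_)) <;> simp only [Prod.mk_add_mk] <;> abel
  map_smul' := by
    rintro c ⟨⟨φ, α, ψ, β⟩, h1, h2, h3, h4, -⟩
    simp only [pencilFun, Submodule.coe_smul,
      pencilRot_smul ev c h3, pencilRot_smul ev c h1, pencilDiv_smul ev c h3,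
      pencilDiv_smul ev c h1, pencilGrad_smul ev c h2, pencilGrad_smul ev c h4,
      RingHom.id_apply, Prod.smul_mk, smul_sub, smul_add, smul_neg,
      smul_comm c Complex.I, smul_comm c (k : ℂ)]

/-- The eigenspace of `𝔄(·, k)` at `ev`: all `Φ ∈ 𝒟H^l(Ω)` with `𝔄(ev, k) Φ = 0`. -/
def eigenspaceA (Ω : PlanarDomain) (l : ℕ+) (k : ℝ) (ev : ℂ) : Submodule ℂ (Field8 Ω) :=
  (LinearMap.ker (pencilA Ω l k ev)).map (DH Ω l).subtype

/-- The domain of the Maxwell pencil: the vectors `(φ, 0, ψ, 0)` in `𝒟H^l(Ω)`. -/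
def domainM (Ω : PlanarDomain) (l : ℕ+) : Submodule ℂ (Field8 Ω) where
  carrier := {Φ | Φ ∈ DH Ω l ∧ Φ.2.1 = 0 ∧ Φ.2.2.2 = 0}
  add_mem' := fun ⟨h, a, b⟩ ⟨h', a', b'⟩ => ⟨add_mem h h', by simp [a, a'], by simp [b, b']⟩
  zero_mem' := ⟨zero_mem _, rfl, rfl⟩
  smul_mem' := fun c _ ⟨h, a, b⟩ => ⟨Submodule.smul_mem _ c h, by simp [a], by simp [b]⟩

/-- The Maxwell pencil `ev ↦ 𝔐(ev, k)`: the restriction of `𝔄(ev, k)` to `domainM`. -/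
def pencilM (Ω : PlanarDomain) (l : ℕ+) (k : ℝ) (ev : ℂ) : domainM Ω l →ₗ[ℂ] Field8 Ω :=
  (pencilA Ω l k ev).comp (Submodule.inclusion fun _ h => h.1)

/-- `ev` is an eigenvalue of the operator pencil `P`. -/
def IsEigenvalue {V W : Type*} [AddCommGroup V] [Module ℂ V] [AddCommGroup W] [Module ℂ W]
    (P : ℂ → V →ₗ[ℂ] W) (ev : ℂ) : Prop :=
  ∃ v : V, v ≠ 0 ∧ P ev v = 0

/-- The constant function with value `c` on `Ω`. -/
def const (Ω : PlanarDomain) (c : ℂ) : L2 Ω := Lp.const 2 Ω.vol c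

/-- The vector `(0, a, (0, 0, b), 0)` with constants `a`, `b`. -/
def constVec (Ω : PlanarDomain) (a b : ℂ) : Field8 Ω :=
  (0, const Ω a, ![0, 0, const Ω b], 0)

end Waveguide

end

/-! Put `ev = s * k` with `s * s = 1`, which covers `ev = ± k` and, with `s = 1`, also `k = ev = 0`.
In the combinations `p = φ 2 + s β` and `q = α - s ψ 2` the equations contain the Cauchy–Riemann
system `∂₀ p = ∂₁ q`, `∂₁ p = -∂₀ q`, and `p` has zero trace. Integration by parts gives `‖∇p‖² =
0`, so `p = 0` and `q` has zero gradient; testing `rot φ` with `q` gives `k q = 0`. The plane field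
`χ = (φ 0 - s ψ 1, φ 1 + s ψ 0)` is then free of divergence and rotation. Two more energy identities
show `β = 0` and `∇(ψ 2) = 0`, so that `φ 2 = 0` and `α`, `ψ 2` are constants. What is left of `ψ`,
and of `φ` after a quarter turn, is an irrotational and solenoidal field tangential to the boundary,
which vanishes on a simply connected domain. This computation is `field_eq_const`; the eigenspace is
read off in `mem_eigenspaceA_iff`, where only the condition `k (a - s b) = 0` on the two constants
survives.

Three analytic facts carry the argument. `integral_green` is the density of test functions of the
plane in `H¹(Ω)` in dual form; it turns the weak boundary conditions into Green's formulas.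
`exists_holomorphic` is Weyl's lemma for the Cauchy–Riemann operator.
`exists_primitive_of_simplyConnected` produces global potentials by lifting to a covering space. The
last two give a tangential field a smooth potential `h`, and testing with the bounded function
`arctan h` shows that the field is zero. -/

noncomputable section

namespace Waveguide

open scoped Convolution ComplexConjugate Pointwise InnerProductSpace
open ContinuousLinearMap (lsmul)

/-! ### Mollification and integration by parts -/

/-- The classical partial derivative `∂_j f` of a complex function in the plane. -/
def partialC (j : Fin 2) (f : Plane → ℂ) (x : Plane) : ℂ :=
  fderiv ℝ f x (EuclideanSpace.single j 1)

lemma continuous_partialC (j : Fin 2) {f : Plane → ℂ} (hf : ContDiff ℝ ∞ f) :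
    Continuous (partialC j f) :=
  (hf.continuous_fderiv (by simp)).clm_apply continuous_const

lemma hasCompactSupport_partialC (j : Fin 2) {f : Plane → ℂ} (hc : HasCompactSupport f) :
    HasCompactSupport (partialC j f) :=
  hc.fderiv_apply (𝕜 := ℝ) _

/-- A mollification is smooth. -/
lemma contDiff_mollify {ρ : Plane → ℝ} (hρ : ContDiff ℝ ∞ ρ) (hc : HasCompactSupport ρ)
    {G : Plane → ℂ} (hG : LocallyIntegrable G volume) :
    ContDiff ℝ ∞ (ρ ⋆[lsmul ℝ ℝ, volume] G) :=
  HasCompactSupport.contDiff_convolution_left (n := ⊤) _ hc hρ hG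

lemma mollify_apply (ρ : Plane → ℝ) (G : Plane → ℂ) (x : Plane) :
    (ρ ⋆[lsmul ℝ ℝ, volume] G) x = ∫ t, ρ (x - t) • G t := by
  rw [convolution_eq_swap]
  rfl

/-- Derivatives of a mollification fall on the mollifier. -/
lemma partialC_mollify {ρ : Plane → ℝ} (hρ : ContDiff ℝ ∞ ρ) (hc : HasCompactSupport ρ)
    {G : Plane → ℂ} (hG : LocallyIntegrable G volume) (j : Fin 2) (x : Plane) :
    partialC j (ρ ⋆[lsmul ℝ ℝ, volume] G) x = ∫ t, partialDeriv j ρ (x - t) • G t := by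
  have hρ1 : ContDiff ℝ 1 ρ := hρ.of_le (by simp)
  -- The differentiation rule used here puts the smooth factor on the right; the flipped bilinear
  -- map exchanges the factors and `convolution_flip` restores them.
  have h := hc.hasFDerivAt_convolution_right (lsmul ℝ ℝ : ℝ →L[ℝ] ℂ →L[ℝ] ℂ).flip hG hρ1 x
  rw [convolution_flip] at h
  rw [partialC, h.fderiv, convolution_precompR_apply _ hG (hc.fderiv ℝ)
    (hρ1.continuous_fderiv (by simp))]
  rfl

/-- The functions `z ↦ ρ (x - z)` are the test functions that express a mollification at `x` as a
pairing. -/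
lemma contDiff_reflect {ρ : Plane → ℝ} (hρ : ContDiff ℝ ∞ ρ) (x : Plane) :
    ContDiff ℝ ∞ fun z => ρ (x - z) := hρ.comp (contDiff_const.sub contDiff_id)

lemma hasCompactSupport_reflect {ρ : Plane → ℝ} (hc : HasCompactSupport ρ) (x : Plane) :
    HasCompactSupport fun z => ρ (x - z) :=
  hc.comp_homeomorph (Homeomorph.subLeft x)

lemma partialDeriv_reflect {ρ : Plane → ℝ} (hρ : ContDiff ℝ ∞ ρ) (x : Plane) (j : Fin 2)
    (z : Plane) : partialDeriv j (fun z => ρ (x - z)) z = -partialDeriv j ρ (x - z) := by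
  have h1 : HasFDerivAt ρ (fderiv ℝ ρ (x - z)) (x - z) :=
    (hρ.differentiable (by simp) _).hasFDerivAt
  have h2 : HasFDerivAt (fun z : Plane => x - z) (-(ContinuousLinearMap.id ℝ Plane)) z := by
    simpa using (hasFDerivAt_id z).const_sub x
  have h3 := h1.comp z h2
  rw [partialDeriv, partialDeriv]
  erw [h3.fderiv]
  simp

/-- A test function times a function that is continuous near its support is integrable. -/
lemma integrable_smul_of_continuousOn {S : Set Plane} (hS : IsOpen S) {η : Plane → ℝ}
    (hη : Continuous η) (hc : HasCompactSupport η) (hs : tsupport η ⊆ S) {f : Plane → ℂ}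
    (hf : ContinuousOn f S) : Integrable (fun x => η x • f x) volume := by
  refine Continuous.integrable_of_hasCompactSupport ?_ hc.smul_right
  refine continuous_of_tsupport fun x hx => ?_
  have hx' : x ∈ S := hs (tsupport_smul_subset_left η f hx)
  exact hη.continuousAt.smul (hf.continuousAt (hS.mem_nhds hx'))

/-- Integration by parts for a function that is continuously differentiable in an open set. -/
lemma integral_partialDeriv_smul {S : Set Plane} (hS : IsOpen S) {η : Plane → ℝ}
    (hη : ContDiff ℝ ∞ η) (hc : HasCompactSupport η) (hs : tsupport η ⊆ S) {f : Plane → ℂ}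
    (hf : ContDiffOn ℝ 1 f S) (j : Fin 2) :
    ∫ x, partialDeriv j η x • f x = -∫ x, η x • partialC j f x := by
  have hd : tsupport (partialDeriv j η) ⊆ S := (tsupport_fderiv_apply_subset ℝ _).trans hs
  have h := integral_smul_fderiv_eq_neg_fderiv_smul_of_integrable (μ := (volume : Measure Plane))
    (𝕜 := ℝ) (f := η) (g := f) (v := EuclideanSpace.single j (1 : ℝ))
    (integrable_smul_of_continuousOn hS (continuous_partialDeriv j hη)
      (hasCompactSupport_partialDeriv j hc) hd hf.continuousOn)
    (integrable_smul_of_continuousOn hS hη.continuous hc hs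
      ((hf.continuousOn_fderiv_of_isOpen hS (by simp)).clm_apply continuousOn_const))
    (integrable_smul_of_continuousOn hS hη.continuous hc hs hf.continuousOn)
    (fun x _ => hη.differentiable (by simp) x)
    (fun x hx => (hf.differentiableOn (by simp)).differentiableAt (hS.mem_nhds (hs hx)))
  simp only [partialC, partialDeriv]
  rw [h, neg_neg]

/-- Weak derivatives can be tested with complex functions. -/
lemma HasWeakPartial.integral_complex {Ω : PlanarDomain} {j : Fin 2} {u v : L2 Ω}
    (h : HasWeakPartial Ω j u v) {f : Plane → ℂ} (hf : ContDiff ℝ ∞ f) (hc : HasCompactSupport f)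
    (hs : tsupport f ⊆ Ω.carrier) :
    ∫ x, partialC j f x * u x ∂Ω.vol = -∫ x, f x * v x ∂Ω.vol := by
  have hre : ContDiff ℝ ∞ fun x => (f x).re := Complex.reCLM.contDiff.comp hf
  have him : ContDiff ℝ ∞ fun x => (f x).im := Complex.imCLM.contDiff.comp hf
  have hcre : HasCompactSupport fun x => (f x).re := hc.comp_left (g := Complex.re) rfl
  have hcim : HasCompactSupport fun x => (f x).im := hc.comp_left (g := Complex.im) rfl
  have hsre : tsupport (fun x => (f x).re) ⊆ Ω.carrier :=
    (closure_mono (Function.support_comp_subset (g := Complex.re) rfl f)).trans hs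
  have hsim : tsupport (fun x => (f x).im) ⊆ Ω.carrier :=
    (closure_mono (Function.support_comp_subset (g := Complex.im) rfl f)).trans hs
  have hpre (x) : partialDeriv j (fun x => (f x).re) x = (partialC j f x).re := by
    have := (Complex.reCLM.hasFDerivAt.comp x (hf.differentiable (by simp) x).hasFDerivAt).fderiv
    rw [partialDeriv]
    erw [this]
    rfl
  have hpim (x) : partialDeriv j (fun x => (f x).im) x = (partialC j f x).im := by
    have := (Complex.imCLM.hasFDerivAt.comp x (hf.differentiable (by simp) x).hasFDerivAt).fderiv
    rw [partialDeriv]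
    erw [this]
    rfl
  have key (g : Plane → ℂ) (w : L2 Ω) (h1 : Integrable (fun x => (g x).re • w x) Ω.vol)
      (h2 : Integrable (fun x => (g x).im • w x) Ω.vol) :
      ∫ x, g x * w x ∂Ω.vol = ∫ x, (g x).re • w x ∂Ω.vol
        + Complex.I * ∫ x, (g x).im • w x ∂Ω.vol := by
    rw [← integral_const_mul, ← integral_add h1 (h2.const_mul _)]
    refine integral_congr_ae (Filter.Eventually.of_forall fun x => ?_)
    simp only [Complex.real_smul]
    conv_lhs => rw [← Complex.re_add_im (g x)]
    ring
  have e1 := h _ hre hcre hsre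
  have e2 := h _ him hcim hsim
  have i1 := integrable_test Ω (continuous_partialDeriv j hre)
    (hasCompactSupport_partialDeriv j hcre) u
  have i2 := integrable_test Ω (continuous_partialDeriv j him)
    (hasCompactSupport_partialDeriv j hcim) u
  simp only [hpre, hpim] at e1 e2 i1 i2
  rw [key _ _ i1 i2, key _ _ (integrable_test Ω hre.continuous hcre v)
    (integrable_test Ω him.continuous hcim v), e1, e2]
  ring

/-! ### Correlations and their averages over shifts -/

/-- Correlations of square-integrable functions are continuous. -/
lemma continuous_integral_mul_translate {U G : Plane → ℂ} (hU : MemLp U 2 volume)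
    (hG : MemLp G 2 volume) : Continuous fun y => ∫ x, U x * G (x - y) := by
  have hmp (y : Plane) : MeasurePreserving (fun x => x - y) (volume : Measure Plane) volume :=
    measurePreserving_sub_right volume y
  -- The correlation is the inner product of `star U` with a translate of `G`, and translation acts
  -- continuously on `L²`.
  let τ : Plane → C(Plane, Plane) := fun y => ⟨fun x => x - y, by fun_prop⟩
  have hτ : Continuous τ := ContinuousMap.continuous_of_continuous_uncurry _
    (by simp only [Function.uncurry_def, τ, ContinuousMap.coe_mk]; fun_prop)
  have hcont : Continuous fun y => Lp.compMeasurePreserving (τ y) (hmp y) (hG.toLp G) :=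
    continuous_const.compMeasurePreservingLp hτ hmp (by simp)
  have hin : Continuous fun y =>
      inner ℂ (hU.star.toLp (star U)) (Lp.compMeasurePreserving (τ y) (hmp y) (hG.toLp G)) :=
    continuous_const.inner hcont
  convert hin using 2 with y
  rw [L2.inner_def]
  refine integral_congr_ae ?_
  filter_upwards [hU.star.coeFn_toLp, Lp.coeFn_compMeasurePreserving (hG.toLp G) (hmp y),
    (hmp y).quasiMeasurePreserving.ae hG.coeFn_toLp] with x h1 h2 h3
  erw [h1, h2]
  simp only [Function.comp_apply, h3, Pi.star_apply, RCLike.inner_apply]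
  simp [mul_comm]

/-- By Fubini, averaging over the shift mollifies `G`. Absolute integrability holds because the
correlation of `‖U‖` and `‖G‖` is itself continuous and `ρ` has compact support. -/
lemma integral_smul_integral_mul_translate {U G : Plane → ℂ} (hU : MemLp U 2 volume)
    (hG : MemLp G 2 volume) {ρ : Plane → ℝ} (hρ : Continuous ρ) (hc : HasCompactSupport ρ) :
    ∫ y, ρ y • ∫ x, U x * G (x - y) = ∫ x, (ρ ⋆[lsmul ℝ ℝ, volume] G) x * U x := by
  have hmp (y : Plane) : MeasurePreserving (fun x => x - y) (volume : Measure Plane) volume :=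
    measurePreserving_sub_right volume y
  have hint (y : Plane) : Integrable (fun x => U x * G (x - y)) volume :=
    hU.integrable_mul (hG.comp_measurePreserving (hmp y))
  have hF : Integrable (Function.uncurry fun y x => ρ y • (U x * G (x - y)))
      ((volume : Measure Plane).prod volume) := by
    have hm : AEStronglyMeasurable (Function.uncurry fun y x => ρ y • (U x * G (x - y)))
        ((volume : Measure Plane).prod volume) := by
      refine (hρ.comp continuous_fst).aestronglyMeasurable.smul
        (hU.1.comp_snd.mul ?_)
      have hq := quasiMeasurePreserving_sub_of_right_invariant (volume : Measure Plane) volume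
      exact (hG.1.comp_quasiMeasurePreserving hq).comp_quasiMeasurePreserving
        (Measure.measurePreserving_swap).quasiMeasurePreserving
    rw [integrable_prod_iff hm]
    refine ⟨Filter.Eventually.of_forall fun y => (hint y).smul (ρ y), ?_⟩
    have hK : Continuous fun y => ∫ x, (‖U x‖ : ℂ) * (‖G (x - y)‖ : ℂ) :=
      continuous_integral_mul_translate (U := fun x => (‖U x‖ : ℂ)) (G := fun x => (‖G x‖ : ℂ))
        hU.norm.ofReal hG.norm.ofReal
    have hK' : Continuous fun y => ‖ρ y‖ * ‖∫ x, (‖U x‖ : ℂ) * (‖G (x - y)‖ : ℂ)‖ :=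
      hρ.norm.mul hK.norm
    refine (hK'.integrable_of_hasCompactSupport hc.norm.mul_right).congr
      (Filter.Eventually.of_forall fun y => ?_)
    simp only [Function.uncurry_apply_pair, norm_smul, norm_mul, ← Complex.ofReal_mul]
    rw [integral_complex_ofReal, Complex.norm_real, Real.norm_of_nonneg
      (integral_nonneg fun x => by positivity), integral_const_mul]
  simp only [← integral_smul]
  rw [integral_integral_swap hF]
  refine integral_congr_ae (Filter.Eventually.of_forall fun x => ?_)
  simp only
  rw [convolution_def, ← integral_mul_const]
  refine integral_congr_ae (Filter.Eventually.of_forall fun y => ?_)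
  simp only [ContinuousLinearMap.lsmul_apply, Complex.real_smul]
  ring

/-! ### Inward shifts at the boundary -/

/-- Near a boundary point, all small shifts in an open set of directions lead into the domain. -/
lemma exists_shift_of_mem_frontier (Ω : PlanarDomain) {p : Plane} (hp : p ∈ frontier Ω.carrier) :
    ∃ r > 0, ∃ W : Set Plane, IsOpen W ∧ (0 : Plane) ∈ closure W ∧
      ∀ x ∈ closure Ω.carrier ∩ Metric.ball p r, ∀ y ∈ W, x + y ∈ Ω.carrier := by
  obtain ⟨e, γ, r, hγ, hr, hU⟩ := Ω.hasSmoothBoundary p hp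
  obtain ⟨M, t, ht, hM⟩ := ((hγ.of_le (by simp : (1 : WithTop ℕ∞) ≤ ∞)).contDiffAt
    (x := e p 0)).exists_lipschitzOnWith
  have hc0 : Continuous fun x => e x 0 := by
    have := e.continuous
    fun_prop
  have hc1 : Continuous fun x => e x 1 := by
    have := e.continuous
    fun_prop
  have hnear : {x | e x 0 ∈ t} ∈ nhds p := hc0.continuousAt.preimage_mem_nhds ht
  obtain ⟨s, hs, hst⟩ := Metric.mem_nhds_iff.mp hnear
  set L := e.linearIsometryEquiv with hL
  -- Half of the minimum: `x` and the shifted point `x + y` both stay within `min r s` of `p`, where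
  -- the graph description and the Lipschitz bound hold.
  set d := min r s / 2 with hd
  have hd0 : 0 < d := by positivity
  have hLc0 : Continuous fun y => L y 0 := by
    have := L.continuous
    fun_prop
  have hLc1 : Continuous fun y => L y 1 := by
    have := L.continuous
    fun_prop
  -- In the rotated coordinates this is a truncated open downward cone whose opening is set by the
  -- local Lipschitz constant `M` of `γ`.
  refine ⟨d, hd0, {y | ‖y‖ < d} ∩ {y | L y 1 + M * |L y 0| < 0}, ?_, ?_, ?_⟩
  · exact (isOpen_lt continuous_norm continuous_const).inter
      (isOpen_lt (hLc1.add (continuous_const.mul hLc0.abs)) continuous_const)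
  · have hlim : Filter.Tendsto (fun t : ℝ => (-t) • L.symm (EuclideanSpace.single 1 1))
        (nhdsWithin 0 (Set.Ioi 0)) (nhds (0 : Plane)) := by
      have : Continuous fun t : ℝ => (-t) • L.symm (EuclideanSpace.single 1 1) := by fun_prop
      have := (this.tendsto 0).mono_left (nhdsWithin_le_nhds (s := Set.Ioi 0))
      simpa using this
    refine mem_closure_of_tendsto hlim ?_
    have h1 : ∀ᶠ t : ℝ in nhdsWithin 0 (Set.Ioi 0), t < d :=
      Filter.Eventually.filter_mono nhdsWithin_le_nhds (gt_mem_nhds hd0)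
    filter_upwards [h1, self_mem_nhdsWithin] with t ht1 ht2
    have ht2' : 0 < t := ht2
    constructor
    · simp [norm_smul, abs_of_pos ht2', ht1]
    · simp [ht2']
  · rintro x ⟨hx, hxp⟩ y ⟨hy, hy2⟩
    simp only [Set.mem_ofPred_eq] at hy hy2
    have hdr : d ≤ r / 2 := by
      have := min_le_left r s
      linarith
    have hds : d ≤ s / 2 := by
      have := min_le_right r s
      linarith
    have hxp' : dist x p < d := hxp
    have hxy : dist (x + y) p < 2 * d := by
      calc dist (x + y) p ≤ dist (x + y) x + dist x p := dist_triangle _ _ _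
        _ < 2 * d := by simp only [dist_self_add_left]; linarith
    -- A point of the closure lies only weakly below the graph; the strict inequality that defines
    -- the cone makes up for this.
    have hle : e x 1 ≤ γ (e x 0) := by
      have hx' : x ∈ closure (Metric.ball p r ∩ Ω.carrier) :=
        Metric.isOpen_ball.inter_closure ⟨Metric.mem_ball.mpr (by linarith), hx⟩
      have hcl : IsClosed {z | e z 1 ≤ γ (e z 0)} :=
        isClosed_le hc1 (hγ.continuous.comp hc0)
      refine closure_minimal ?_ hcl hx'
      rintro z ⟨hz, hz'⟩
      exact ((hU z hz).mp hz').le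
    have hexy : e (x + y) = L y + e x := by
      have := e.map_vadd x y
      simpa [add_comm] using this
    rw [hU _ (Metric.mem_ball.mpr (by linarith)), hexy]
    have m1 : e x 0 ∈ t := hst (Metric.mem_ball.mpr (by linarith))
    have m2 : L y 0 + e x 0 ∈ t := by
      have : e (x + y) 0 ∈ t := hst (Metric.mem_ball.mpr (by linarith))
      rwa [hexy] at this
    have hlip := hM.dist_le_mul _ m2 _ m1
    rw [Real.dist_eq, Real.dist_eq, add_sub_cancel_right] at hlip
    have := (abs_le.mp hlip).1
    simp only [PiLp.add_apply]
    linarith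

/-- Near a point of the closure, all small shifts in an open set of directions lead into the
domain. -/
lemma exists_shift (Ω : PlanarDomain) {p : Plane} (hp : p ∈ closure Ω.carrier) :
    ∃ r > 0, ∃ W : Set Plane, IsOpen W ∧ (0 : Plane) ∈ closure W ∧
      ∀ x ∈ closure Ω.carrier ∩ Metric.ball p r, ∀ y ∈ W, x + y ∈ Ω.carrier := by
  by_cases hin : p ∈ Ω.carrier
  · obtain ⟨r, hr, hball⟩ := Metric.isOpen_iff.mp Ω.isOpen p hin
    refine ⟨r / 2, by positivity, Metric.ball 0 (r / 2), Metric.isOpen_ball,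
      subset_closure (Metric.mem_ball_self (by positivity)), ?_⟩
    rintro x ⟨-, hx⟩ y hy
    refine hball (Metric.mem_ball.mpr ?_)
    rw [Metric.mem_ball] at hx
    rw [mem_ball_zero_iff] at hy
    calc dist (x + y) p ≤ dist (x + y) x + dist x p := dist_triangle _ _ _
      _ < r := by simp only [dist_self_add_left]; linarith
  · exact exists_shift_of_mem_frontier Ω ⟨hp, by rwa [Ω.isOpen.interior_eq]⟩

/-! ### Green's formula: from test functions of the plane to `H¹(Ω)` -/

lemma integral_add_add {μ : Measure Plane} {f g h : Plane → ℂ} (hf : Integrable f μ)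
    (hg : Integrable g μ) (hh : Integrable h μ) :
    ∫ x, (f x + g x + h x) ∂μ = ∫ x, f x ∂μ + ∫ x, g x ∂μ + ∫ x, h x ∂μ := by
  rw [← integral_add hf hg]
  exact integral_add (hf.add hg) hh

/-- Extension by zero. -/
lemma memLp_indicator (Ω : PlanarDomain) (u : L2 Ω) :
    MemLp (Ω.carrier.indicator u) 2 volume :=
  (memLp_indicator_iff_restrict Ω.isOpen.measurableSet).mpr (Lp.memLp u)

lemma integral_vol_mul_eq (Ω : PlanarDomain) (f u : Plane → ℂ) :
    ∫ x, f x * u x ∂Ω.vol = ∫ x, f x * Ω.carrier.indicator u x := by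
  rw [← integral_indicator Ω.isOpen.measurableSet]
  congr with x
  by_cases hx : x ∈ Ω.carrier <;> simp [hx]

/-- Integrals against test functions over `Ω` and over the plane. -/
lemma integral_smul_indicator (Ω : PlanarDomain) (ζ : Plane → ℝ) (f : Plane → ℂ) :
    ∫ x, ζ x • Ω.carrier.indicator f x = ∫ x, ζ x • f x ∂Ω.vol := by
  rw [← integral_indicator Ω.isOpen.measurableSet]
  congr with x
  by_cases hx : x ∈ Ω.carrier <;> simp [hx]

/-- The mollification of a function with compact support `K` is supported in `K + tsupport ρ`. -/
lemma tsupport_mollify_subset {ρ : Plane → ℝ} (hc : HasCompactSupport ρ) {G : Plane → ℂ}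
    {K : Set Plane} (hK : IsCompact K) (hG : ∀ x ∉ K, G x = 0) :
    tsupport (ρ ⋆[lsmul ℝ ℝ, volume] G) ⊆ K + tsupport ρ := by
  have hcl : IsClosed (K + tsupport ρ) := (hK.add hc).isClosed
  refine closure_minimal (fun x hx => ?_) hcl
  have h1 := support_convolution_subset (lsmul ℝ ℝ : ℝ →L[ℝ] ℂ →L[ℝ] ℂ) (μ := volume) hx
  rw [add_comm]
  refine Set.add_subset_add (subset_tsupport ρ) (fun y hy => ?_) h1
  by_contra hyK
  exact hy (hG y hyK)

section Green

variable {Ω : PlanarDomain} {u u₀ u₁ : L2 Ω}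

/-- If `(g₀, g₁, g₂)` annihilates the gradients of all test functions in the plane, and is
supported where small shifts lead into the domain, then it annihilates the gradients of all
functions in `H¹(Ω)`. -/
lemma integral_eq_zero_of_shift (hu₀ : HasWeakPartial Ω 0 u u₀) (hu₁ : HasWeakPartial Ω 1 u u₁)
    {g₀ g₁ g₂ : Plane → ℂ} (h₀ : MemLp g₀ 2 volume) (h₁ : MemLp g₁ 2 volume)
    (h₂ : MemLp g₂ 2 volume) {K W : Set Plane} (hK : IsCompact K) (hW : IsOpen W)
    (hW0 : (0 : Plane) ∈ closure W) (hKW : ∀ x ∈ K, ∀ y ∈ W, x + y ∈ Ω.carrier)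
    (hK₁ : ∀ x ∉ K, g₁ x = 0) (hK₂ : ∀ x ∉ K, g₂ x = 0)
    (hg : ∀ η : Plane → ℝ, ContDiff ℝ ∞ η → HasCompactSupport η →
      (∫ x, η x • g₀ x) + (∫ x, partialDeriv 0 η x • g₁ x) + (∫ x, partialDeriv 1 η x • g₂ x) = 0) :
    ∫ x, g₀ x * u x ∂Ω.vol + ∫ x, g₁ x * u₀ x ∂Ω.vol + ∫ x, g₂ x * u₁ x ∂Ω.vol = 0 := by
  set U := Ω.carrier.indicator u
  set U₀ := Ω.carrier.indicator u₀
  set U₁ := Ω.carrier.indicator u₁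
  have hU := memLp_indicator Ω u
  have hU₀ := memLp_indicator Ω u₀
  have hU₁ := memLp_indicator Ω u₁
  have l₀ := h₀.locallyIntegrable (by norm_num)
  have l₁ := h₁.locallyIntegrable (by norm_num)
  have l₂ := h₂.locallyIntegrable (by norm_num)
  -- `F y` is the functional with `(g₀, g₁, g₂)` translated by `y`, and `F 0` is the claimed
  -- quantity. For `y` in `W` the translate has its support inside `Ω`; the proof shows `F = 0` on
  -- `W` and passes to `0` by continuity.
  let F : Plane → ℂ := fun y =>
    (∫ x, U x * g₀ (x - y)) + (∫ x, U₀ x * g₁ (x - y)) + (∫ x, U₁ x * g₂ (x - y))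
  have c₀ := continuous_integral_mul_translate hU h₀
  have c₁ := continuous_integral_mul_translate hU₀ h₁
  have c₂ := continuous_integral_mul_translate hU₁ h₂
  have hFc : Continuous F := (c₀.add c₁).add c₂
  have hzero : ∀ ρ : Plane → ℝ, ContDiff ℝ ∞ ρ → HasCompactSupport ρ → tsupport ρ ⊆ W →
      ∫ y, ρ y • F y = 0 := by
    intro ρ hρ hc hs
    have hin {f : Plane → ℂ} (hf : Continuous f) : Integrable (fun y => ρ y • f y) volume :=
      (hρ.continuous.smul hf).integrable_of_hasCompactSupport hc.smul_right
    have hsplit : ∫ y, ρ y • F y = (∫ x, (ρ ⋆[lsmul ℝ ℝ, volume] g₀) x * U x)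
        + (∫ x, (ρ ⋆[lsmul ℝ ℝ, volume] g₁) x * U₀ x)
        + (∫ x, (ρ ⋆[lsmul ℝ ℝ, volume] g₂) x * U₁ x) := by
      rw [← integral_smul_integral_mul_translate hU h₀ hρ.continuous hc,
        ← integral_smul_integral_mul_translate hU₀ h₁ hρ.continuous hc,
        ← integral_smul_integral_mul_translate hU₁ h₂ hρ.continuous hc]
      simp only [F, smul_add]
      exact integral_add_add (hin c₀) (hin c₁) (hin c₂)
    -- The hypothesis tested with `z ↦ ρ (x - z)` becomes a pointwise identity between
    -- mollifications.
    have hconv (x : Plane) : (ρ ⋆[lsmul ℝ ℝ, volume] g₀) x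
        = partialC 0 (ρ ⋆[lsmul ℝ ℝ, volume] g₁) x
          + partialC 1 (ρ ⋆[lsmul ℝ ℝ, volume] g₂) x := by
      have := hg _ (contDiff_reflect hρ x) (hasCompactSupport_reflect hc x)
      simp only [partialDeriv_reflect hρ, neg_smul, integral_neg] at this
      rw [mollify_apply, partialC_mollify hρ hc l₁, partialC_mollify hρ hc l₂]
      linear_combination this
    -- Mollifying with support in `W` moves `K` into `Ω`, so the mollified `g₁` and `g₂` are
    -- admissible in the definition of the weak derivatives of `u`.
    have hsub {G : Plane → ℂ} (hG : ∀ x ∉ K, G x = 0) :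
        tsupport (ρ ⋆[lsmul ℝ ℝ, volume] G) ⊆ Ω.carrier := by
      refine (tsupport_mollify_subset hc hK hG).trans ?_
      rintro _ ⟨x, hx, y, hy, rfl⟩
      exact hKW x hx y (hs hy)
    have hcs {G : Plane → ℂ} (hG : ∀ x ∉ K, G x = 0) :
        HasCompactSupport (ρ ⋆[lsmul ℝ ℝ, volume] G) :=
      (hK.add hc).of_isClosed_subset (isClosed_tsupport _) (tsupport_mollify_subset hc hK hG)
    have w₀ := hu₀.integral_complex (contDiff_mollify hρ hc l₁) (hcs hK₁) (hsub hK₁)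
    have w₁ := hu₁.integral_complex (contDiff_mollify hρ hc l₂) (hcs hK₂) (hsub hK₂)
    rw [integral_vol_mul_eq, integral_vol_mul_eq] at w₀ w₁
    have hUi {f : Plane → ℂ} (hf : Continuous f) (hcf : HasCompactSupport f) :
        Integrable (fun x => f x * U x) volume :=
      (hf.memLp_of_hasCompactSupport (p := 2) hcf).integrable_mul hU
    rw [hsplit]
    simp only [hconv, add_mul]
    rw [integral_add (hUi (continuous_partialC 0 (contDiff_mollify hρ hc l₁))
        (hasCompactSupport_partialC 0 (hcs hK₁)))
      (hUi (continuous_partialC 1 (contDiff_mollify hρ hc l₂))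
        (hasCompactSupport_partialC 1 (hcs hK₂)))]
    linear_combination w₀ + w₁
  have hae := hW.ae_eq_zero_of_integral_contDiff_smul_eq_zero
    (hFc.locallyIntegrable.locallyIntegrableOn W) hzero
  have hEq : Set.EqOn F 0 W := Measure.eqOn_open_of_ae_eq (μ := (volume : Measure Plane))
    ((ae_restrict_iff' hW.measurableSet).mpr hae) hW hFc.continuousOn continuousOn_const
  have h0 : F 0 = 0 := hEq.closure hFc continuous_const hW0
  rw [integral_vol_mul_eq, integral_vol_mul_eq, integral_vol_mul_eq]
  simpa [F, mul_comm] using h0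

lemma memLp_smul (Ω : PlanarDomain) {θ : Plane → ℝ} (hθ : Continuous θ)
    (hc : HasCompactSupport θ) (g : L2 Ω) : MemLp (fun x => θ x • g x) 2 Ω.vol :=
  (Lp.memLp g).smul (r := 2) (hθ.memLp_top_of_hasCompactSupport hc Ω.vol)

lemma integrable_smul_mul (Ω : PlanarDomain) {θ : Plane → ℝ} (hθ : Continuous θ)
    (hc : HasCompactSupport θ) (g w : L2 Ω) : Integrable (fun x => θ x • (g x * w x)) Ω.vol := by
  have := (memLp_smul Ω hθ hc g).integrable_mul (Lp.memLp w)
  refine this.congr (Filter.Eventually.of_forall fun x => ?_)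
  simp only [Pi.mul_apply, smul_mul_assoc]

lemma partialDeriv_mul {θ η : Plane → ℝ} (hθ : ContDiff ℝ ∞ θ) (hη : ContDiff ℝ ∞ η) (j : Fin 2)
    (x : Plane) : partialDeriv j (fun x => θ x * η x) x
      = θ x * partialDeriv j η x + η x * partialDeriv j θ x := by
  rw [partialDeriv, fderiv_fun_mul (hθ.differentiable (by simp) x)
    (hη.differentiable (by simp) x)]
  simp [partialDeriv]

/-- The localized form of the density of test functions in `H¹(Ω)`. -/
lemma integral_green_local (hu₀ : HasWeakPartial Ω 0 u u₀) (hu₁ : HasWeakPartial Ω 1 u u₁)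
    {g₀ g₁ g₂ : L2 Ω} (hg : ∀ η : Plane → ℝ, ContDiff ℝ ∞ η → HasCompactSupport η →
      ∫ x, η x • g₀ x ∂Ω.vol + ∫ x, partialDeriv 0 η x • g₁ x ∂Ω.vol
        + ∫ x, partialDeriv 1 η x • g₂ x ∂Ω.vol = 0)
    {p : Plane} {r : ℝ} {W : Set Plane} (hW : IsOpen W) (hW0 : (0 : Plane) ∈ closure W)
    (hpW : ∀ x ∈ closure Ω.carrier ∩ Metric.ball p r, ∀ y ∈ W, x + y ∈ Ω.carrier)
    {θ : Plane → ℝ} (hθ : ContDiff ℝ ∞ θ) (hc : HasCompactSupport θ)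
    (hs : tsupport θ ⊆ Metric.ball p r) :
    ∫ x, (θ x • (g₀ x * u x + g₁ x * u₀ x + g₂ x * u₁ x)
      + partialDeriv 0 θ x • (g₁ x * u x) + partialDeriv 1 θ x • (g₂ x * u x)) ∂Ω.vol = 0 := by
  have hm := Ω.isOpen.measurableSet
  have cθ := hθ.continuous
  have c0 := continuous_partialDeriv 0 hθ
  have c1 := continuous_partialDeriv 1 hθ
  have s0 := hasCompactSupport_partialDeriv 0 hc
  have s1 := hasCompactSupport_partialDeriv 1 hc
  -- With `θ η` as test function, the product rule moves the terms containing `∂θ` into the zeroth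
  -- order component.
  have m0 := ((memLp_smul Ω cθ hc g₀).add (memLp_smul Ω c0 s0 g₁)).add (memLp_smul Ω c1 s1 g₂)
  have key := integral_eq_zero_of_shift hu₀ hu₁
    ((memLp_indicator_iff_restrict hm).mpr m0)
    ((memLp_indicator_iff_restrict hm).mpr (memLp_smul Ω cθ hc g₁))
    ((memLp_indicator_iff_restrict hm).mpr (memLp_smul Ω cθ hc g₂))
    (K := closure Ω.carrier ∩ tsupport θ) (W := W)
    (hc.inter_left isClosed_closure) hW hW0 (fun x hx => hpW x ⟨hx.1, hs hx.2⟩) ?_ ?_ ?_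
  · have hind {f : Plane → ℂ} {w : L2 Ω} :
        ∫ x, Ω.carrier.indicator f x * w x ∂Ω.vol = ∫ x, f x * w x ∂Ω.vol := by
      refine setIntegral_congr_fun hm fun x hx => ?_
      simp only [Set.indicator_of_mem hx]
    rw [hind, hind, hind] at key
    rw [← key, ← integral_add, ← integral_add]
    · refine integral_congr_ae (Filter.Eventually.of_forall fun x => ?_)
      simp only [Pi.add_apply, Complex.real_smul]
      ring
    · exact (m0.integrable_mul (Lp.memLp u)).add
        ((memLp_smul Ω cθ hc g₁).integrable_mul (Lp.memLp u₀))
    · exact (memLp_smul Ω cθ hc g₂).integrable_mul (Lp.memLp u₁)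
    · exact m0.integrable_mul (Lp.memLp u)
    · exact (memLp_smul Ω cθ hc g₁).integrable_mul (Lp.memLp u₀)
  · intro x hx
    by_cases hxΩ : x ∈ Ω.carrier
    · have : x ∉ tsupport θ := fun h => hx ⟨subset_closure hxΩ, h⟩
      simp [image_eq_zero_of_notMem_tsupport this]
    · simp [hxΩ]
  · intro x hx
    by_cases hxΩ : x ∈ Ω.carrier
    · have : x ∉ tsupport θ := fun h => hx ⟨subset_closure hxΩ, h⟩
      simp [image_eq_zero_of_notMem_tsupport this]
    · simp [hxΩ]
  · intro η hη hηc
    rw [integral_smul_indicator, integral_smul_indicator, integral_smul_indicator]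
    have h := hg (fun x => θ x * η x) (hθ.mul hη) hc.mul_right
    simp only [partialDeriv_mul hθ hη] at h
    rw [← h]
    have i1 := integrable_test Ω (cθ.mul hη.continuous) hc.mul_right g₀
    have i2 := integrable_test Ω (hη.continuous.mul c0) hηc.mul_right g₁
    have i3 := integrable_test Ω (hη.continuous.mul c1) hηc.mul_right g₂
    have i4 := integrable_test Ω (cθ.mul (continuous_partialDeriv 0 hη)) hc.mul_right g₁
    have i5 := integrable_test Ω (cθ.mul (continuous_partialDeriv 1 hη)) hc.mul_right g₂
    simp only [Pi.mul_apply] at i1 i2 i3 i4 i5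
    simp only [add_smul, Pi.add_apply, smul_add, smul_smul]
    rw [integral_add i4 i2, integral_add i5 i3]
    have e : ∫ x, ((η x * θ x) • g₀ x + (η x * partialDeriv 0 θ x) • g₁ x
        + (η x * partialDeriv 1 θ x) • g₂ x) ∂Ω.vol = ∫ x, (θ x * η x) • g₀ x ∂Ω.vol
        + ∫ x, (η x * partialDeriv 0 θ x) • g₁ x ∂Ω.vol
        + ∫ x, (η x * partialDeriv 1 θ x) • g₂ x ∂Ω.vol := by
      simp only [mul_comm (η _) (θ _)]
      exact integral_add_add i1 i2 i3
    rw [e]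
    simp only [mul_comm (partialDeriv _ η _) (θ _)]
    ring

open scoped Manifold in
/-- A functional of `(u, ∇u)` that vanishes on all test functions of the plane vanishes on
`H¹(Ω)`. -/
theorem integral_green (hu₀ : HasWeakPartial Ω 0 u u₀) (hu₁ : HasWeakPartial Ω 1 u u₁)
    {g₀ g₁ g₂ : L2 Ω} (hg : ∀ η : Plane → ℝ, ContDiff ℝ ∞ η → HasCompactSupport η →
      ∫ x, η x • g₀ x ∂Ω.vol + ∫ x, partialDeriv 0 η x • g₁ x ∂Ω.vol
        + ∫ x, partialDeriv 1 η x • g₂ x ∂Ω.vol = 0) :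
    ∫ x, (g₀ x * u x + g₁ x * u₀ x + g₂ x * u₁ x) ∂Ω.vol = 0 := by
  have hK : IsCompact (closure Ω.carrier) := Ω.isBounded.isCompact_closure
  choose! r hr W hW hW0 hWΩ using fun p (hp : p ∈ closure Ω.carrier) => exists_shift Ω hp
  obtain ⟨T, hTK, hT⟩ := hK.elim_nhds_subcover (fun p => Metric.ball p (r p))
    (fun p hp => Metric.ball_mem_nhds p (hr p hp))
  obtain ⟨f, hf⟩ := SmoothPartitionOfUnity.exists_isSubordinate 𝓘(ℝ, Plane)
    (isClosed_closure (s := Ω.carrier)) (fun p : T => Metric.ball (p : Plane) (r p))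
    (fun p => Metric.isOpen_ball) (by simpa [Set.iUnion_subtype] using hT)
  have hsm (i : T) : ContDiff ℝ ∞ (f i) := (f i).contMDiff.contDiff
  have hcs (i : T) : HasCompactSupport (f i) :=
    (isCompact_closedBall (i : Plane) (r i)).of_isClosed_subset (isClosed_tsupport _)
      ((hf i).trans Metric.ball_subset_closedBall)
  have hloc (i : T) := integral_green_local hu₀ hu₁ hg (hW i (hTK i i.2)) (hW0 i (hTK i i.2))
    (hWΩ i (hTK i i.2)) (hsm i) (hcs i) (hf i)
  have hsum (x : Plane) (hx : x ∈ closure Ω.carrier) : ∑ i, f i x = 1 := by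
    rw [← f.sum_eq_one hx, finsum_eq_sum_of_fintype]
  -- The partition sums to one on the open set `Ω`, so the gradients of its members cancel there and
  -- the localization errors disappear on summation.
  have hdsum (j : Fin 2) (x : Plane) (hx : x ∈ Ω.carrier) :
      ∑ i, partialDeriv j (f i) x = 0 := by
    have h1 : fderiv ℝ (fun y => ∑ i, f i y) x = 0 := by
      have : (fun y => ∑ i, f i y) =ᶠ[nhds x] fun _ => (1 : ℝ) := by
        filter_upwards [Ω.isOpen.mem_nhds hx] with y hy using hsum y (subset_closure hy)
      rw [this.fderiv_eq]
      simp
    rw [fderiv_fun_sum fun i _ => (hsm i).differentiable (by simp) x] at h1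
    simpa [partialDeriv] using congrArg (fun L => L (EuclideanSpace.single j (1 : ℝ))) h1
  have htot : ∑ i, ∫ x, (f i x • (g₀ x * u x + g₁ x * u₀ x + g₂ x * u₁ x)
      + partialDeriv 0 (f i) x • (g₁ x * u x)
      + partialDeriv 1 (f i) x • (g₂ x * u x)) ∂Ω.vol = 0 :=
    Finset.sum_eq_zero fun i _ => hloc i
  rw [← integral_finsetSum] at htot
  · rw [← htot]
    refine setIntegral_congr_fun Ω.isOpen.measurableSet fun x hx => ?_
    simp only [Finset.sum_add_distrib, ← Finset.sum_smul, hsum x (subset_closure hx),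
      hdsum _ x hx, zero_smul, one_smul, add_zero]
  · intro i _
    have cθ := (hsm i).continuous
    have i0 := ((integrable_smul_mul Ω cθ (hcs i) g₀ u).add
      (integrable_smul_mul Ω cθ (hcs i) g₁ u₀)).add (integrable_smul_mul Ω cθ (hcs i) g₂ u₁)
    have i1 := integrable_smul_mul Ω (continuous_partialDeriv 0 (hsm i))
      (hasCompactSupport_partialDeriv 0 (hcs i)) g₁ u
    have i2 := integrable_smul_mul Ω (continuous_partialDeriv 1 (hsm i))
      (hasCompactSupport_partialDeriv 1 (hcs i)) g₂ u
    refine ((i0.add i1).add i2).congr (Filter.Eventually.of_forall fun x => ?_)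
    simp only [Pi.add_apply, smul_add]

end Green

/-! ### Weyl's lemma for the Cauchy–Riemann operator -/

/-- A holomorphic function is reproduced by averaging with a radial weight. -/
lemma integral_radial_smul_holomorphic {f : ℂ → ℂ} {c : ℂ} {R δ : ℝ}
    (hf : DifferentiableOn ℂ f (Metric.ball c R)) (hδ : δ < R) {g : ℝ → ℝ}
    (hg : Continuous fun z : ℂ => g ‖z‖) (hsupp : ∀ z : ℂ, δ < ‖z‖ → g ‖z‖ = 0) :
    ∫ z : ℂ, g ‖z‖ • f (c - z) = (∫ z : ℂ, g ‖z‖) • f c := by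
  set B := Metric.closedBall (0 : ℂ) δ
  have hB : MeasurableSet B := Metric.isClosed_closedBall.measurableSet
  have hout {z : ℂ} (hz : z ∉ B) : g ‖z‖ = 0 := hsupp z (by simpa [B] using hz)
  have hset (h : ℂ → ℂ) : ∫ z : ℂ, g ‖z‖ • h z = ∫ z in B, g ‖z‖ • h z :=
    (setIntegral_eq_integral_of_forall_compl_eq_zero fun z hz => by rw [hout hz, zero_smul]).symm
  -- Lebesgue measure and the radial weight are both invariant under rotation, so the integral may
  -- be averaged over `θ`.
  have hrot (θ : ℝ) : ∫ z : ℂ, g ‖z‖ • f (c - z)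
      = ∫ z in B, g ‖z‖ • f (c - Circle.exp θ * z) := by
    rw [← hset fun z => f (c - Circle.exp θ * z)]
    have hmp := (rotation (Circle.exp θ)).measurePreserving
    rw [← hmp.integral_comp (rotation (Circle.exp θ)).toHomeomorph.measurableEmbedding]
    simp [rotation_apply]
  -- The mean value property, applied to `w ↦ f (c - w * z)` on the unit disc; in this form `z = 0`
  -- is not exceptional.
  have hcirc {z : ℂ} (hz : z ∈ B) :
      ∫ θ in (0 : ℝ)..2 * Real.pi, f (c - Circle.exp θ * z) = (2 * Real.pi) • f c := by
    have hz' : ‖z‖ ≤ δ := by simpa [B] using hz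
    have hmaps : ∀ w ∈ Metric.closedBall (0 : ℂ) 1, c - w * z ∈ Metric.ball c R := by
      intro w hw
      rw [mem_closedBall_zero_iff] at hw
      rw [mem_ball_iff_norm]
      have : ‖w * z‖ ≤ δ := by
        rw [norm_mul]
        calc ‖w‖ * ‖z‖ ≤ 1 * ‖z‖ := by gcongr
          _ ≤ δ := by rwa [one_mul]
      simpa using this.trans_lt hδ
    have hd : DifferentiableOn ℂ (fun w => f (c - w * z)) (Metric.closedBall 0 1) :=
      hf.comp (by fun_prop) hmaps
    have hdc : DiffContOnCl ℂ (fun w => f (c - w * z)) (Metric.ball 0 |(1 : ℝ)|) := by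
      refine DifferentiableOn.diffContOnCl ?_
      rw [abs_one, closure_ball _ one_ne_zero]
      exact hd
    have h := hdc.circleAverage
    rw [Real.circleAverage_def] at h
    simp only [circleMap, zero_add, Complex.ofReal_one, one_mul, zero_mul, sub_zero] at h
    simp only [Circle.coe_exp]
    rw [← h, smul_smul, mul_inv_cancel₀ (by positivity), one_smul]
  have hcont : ContinuousOn (fun p : ℂ × ℝ => g ‖p.1‖ • f (c - Circle.exp p.2 * p.1))
      (B ×ˢ Set.Icc 0 (2 * Real.pi)) := by
    refine ((hg.comp continuous_fst).continuousOn).smul (hf.continuousOn.comp ?_ ?_)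
    · exact Continuous.continuousOn (by fun_prop)
    · rintro ⟨z, θ⟩ ⟨hz, -⟩
      have hz' : ‖z‖ ≤ δ := by simpa [B] using hz
      simpa using hz'.trans_lt hδ
  have hint : Integrable (Function.uncurry fun (z : ℂ) (θ : ℝ) =>
      g ‖z‖ • f (c - Circle.exp θ * z))
      ((volume.restrict B).prod (volume.restrict (Set.Ioc 0 (2 * Real.pi)))) := by
    rw [Measure.prod_restrict]
    have := hcont.integrableOn_compact ((isCompact_closedBall (0 : ℂ) δ).prod isCompact_Icc)
      (μ := (volume : Measure ℂ).prod (volume : Measure ℝ))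
    exact this.mono_set (Set.prod_mono le_rfl Set.Ioc_subset_Icc_self)
  have hpi : (0 : ℝ) ≤ 2 * Real.pi := by positivity
  have h1 : (2 * Real.pi) • ∫ z : ℂ, g ‖z‖ • f (c - z)
      = (2 * Real.pi) • ((∫ z : ℂ, g ‖z‖) • f c) := by
    calc (2 * Real.pi) • ∫ z : ℂ, g ‖z‖ • f (c - z)
        = ∫ θ in Set.Ioc 0 (2 * Real.pi), ∫ z in B, g ‖z‖ • f (c - Circle.exp θ * z) := by
          rw [setIntegral_congr_fun measurableSet_Ioc fun θ _ => (hrot θ).symm]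
          simp [hpi]
      _ = ∫ z in B, ∫ θ in Set.Ioc 0 (2 * Real.pi), g ‖z‖ • f (c - Circle.exp θ * z) :=
          (integral_integral_swap hint).symm
      _ = ∫ z in B, g ‖z‖ • ((2 * Real.pi) • f c) := by
          refine setIntegral_congr_fun hB fun z hz => ?_
          rw [integral_smul, ← intervalIntegral.integral_of_le hpi, hcirc hz]
      _ = (2 * Real.pi) • ((∫ z : ℂ, g ‖z‖) • f c) := by
          rw [← hset fun _ => (2 * Real.pi) • f c, integral_smul_const, smul_comm]
  exact smul_right_injective _ (by positivity : (2 * Real.pi : ℝ) ≠ 0) h1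

/-- There are radial mollifiers with arbitrarily small support. -/
lemma exists_radial_mollifier {δ : ℝ} (hδ : 0 < δ) : ∃ (ρ : Plane → ℝ) (g : ℝ → ℝ),
    ContDiff ℝ ∞ ρ ∧ tsupport ρ ⊆ Metric.closedBall 0 δ ∧ Continuous g ∧
      (∀ s, δ < s → g s = 0) ∧ (∀ x, ρ x = g ‖x‖) ∧ ∫ x, ρ x = 1 := by
  -- The profile depends on `s ^ 2`, so `h ‖x‖` is smooth at the origin as well.
  let h : ℝ → ℝ := fun s => Real.smoothTransition (1 - s ^ 2 / δ ^ 2)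
  have hcont : Continuous h := Real.smoothTransition.continuous.comp (by fun_prop)
  have hzero : ∀ s, δ < s → h s = 0 := fun s hs => by
    refine Real.smoothTransition.zero_of_nonpos ?_
    rw [sub_nonpos, one_le_div (by positivity)]
    gcongr
  have hsm : ContDiff ℝ ∞ fun x : Plane => h ‖x‖ := by
    refine Real.smoothTransition.contDiff.comp ?_
    exact contDiff_const.sub ((contDiff_norm_sq ℝ).div_const _)
  have hts : tsupport (fun x : Plane => h ‖x‖) ⊆ Metric.closedBall 0 δ := by
    refine closure_minimal (fun x hx => ?_) Metric.isClosed_closedBall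
    rw [mem_closedBall_zero_iff]
    by_contra hlt
    exact hx (hzero _ (not_le.mp hlt))
  have hcs : HasCompactSupport fun x : Plane => h ‖x‖ :=
    (isCompact_closedBall (0 : Plane) δ).of_isClosed_subset (isClosed_tsupport _) hts
  have hpos : 0 < ∫ x : Plane, h ‖x‖ := by
    refine hsm.continuous.integral_pos_of_hasCompactSupport_nonneg_nonzero hcs
      (fun x => Real.smoothTransition.nonneg _) (x := 0) ?_
    simp [h]
  refine ⟨fun x => (∫ x : Plane, h ‖x‖)⁻¹ * h ‖x‖, fun s => (∫ x : Plane, h ‖x‖)⁻¹ * h s,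
    contDiff_const.mul hsm, ?_, continuous_const.mul hcont, fun s hs => by simp [hzero s hs],
    fun x => rfl, ?_⟩
  · exact (closure_mono (Function.support_mul_subset_right _ _)).trans hts
  · rw [integral_const_mul, inv_mul_cancel₀ hpos.ne']

/-- The Cauchy–Riemann equation at a point. -/
def IsCR (f : Plane → ℂ) (x : Plane) : Prop :=
  DifferentiableAt ℝ f x ∧ partialC 1 f x = Complex.I * partialC 0 f x

/-- Radial mollification does not change a holomorphic function. -/
lemma mollify_eq_of_isCR {f : Plane → ℂ} {x : Plane} {R δ : ℝ} (hδ : δ < R)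
    (hf : ∀ y ∈ Metric.ball x R, IsCR f y) {ρ : Plane → ℝ} {g : ℝ → ℝ} (hg : Continuous g)
    (hsupp : ∀ s, δ < s → g s = 0) (hρ : ∀ x, ρ x = g ‖x‖) (hint : ∫ x, ρ x = 1) :
    (ρ ⋆[lsmul ℝ ℝ, volume] f) x = f x := by
  -- This isometry sends `1` and `i` to the coordinate vectors, so that `IsCR` becomes complex
  -- differentiability and integrals are preserved.
  let T : ℂ ≃ₗᵢ[ℝ] Plane := Complex.orthonormalBasisOneI.repr
  have hT1 : T 1 = EuclideanSpace.single 0 1 := by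
    simpa using Complex.orthonormalBasisOneI.repr_self 0
  have hTI : T Complex.I = EuclideanSpace.single 1 1 := by
    simpa using Complex.orthonormalBasisOneI.repr_self 1
  have hmp := T.measurePreserving
  have htrans {E : Type} [NormedAddCommGroup E] [NormedSpace ℝ E] (F : Plane → E) :
      ∫ z : ℂ, F (T z) = ∫ y, F y :=
    hmp.integral_comp T.toHomeomorph.measurableEmbedding F
  have hd : DifferentiableOn ℂ (fun z => f (T z)) (Metric.ball (T.symm x) R) := by
    intro z hz
    refine DifferentiableAt.differentiableWithinAt ?_
    have hz' : T z ∈ Metric.ball x R := by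
      rw [Metric.mem_ball] at hz ⊢
      rwa [← T.apply_symm_apply x, T.dist_map]
    obtain ⟨h1, h2⟩ := hf _ hz'
    have hder : HasFDerivAt (fun z => f (T z))
        ((fderiv ℝ f (T z)).comp (T.toContinuousLinearEquiv : ℂ →L[ℝ] Plane)) z :=
      h1.hasFDerivAt.comp z T.toContinuousLinearEquiv.hasFDerivAt
    rw [differentiableAt_complex_iff_differentiableAt_real]
    refine ⟨hder.differentiableAt, ?_⟩
    rw [hder.fderiv]
    simp only [partialC] at h2
    simp [hT1, hTI, h2]
  have key := integral_radial_smul_holomorphic hd hδ (hg.comp continuous_norm)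
    (fun z hz => hsupp _ hz)
  have e1 : ∫ z : ℂ, g ‖z‖ = 1 := by
    rw [← hint, ← htrans]
    simp [hρ]
  rw [e1, one_smul, T.apply_symm_apply] at key
  rw [convolution_def, ← key, ← htrans]
  simp [hρ]

/-- Mollifications of a weakly holomorphic function are holomorphic. -/
lemma isCR_mollify {S : Set Plane} {U : Plane → ℂ} (hU : LocallyIntegrable U volume)
    (h : ∀ η : Plane → ℝ, ContDiff ℝ ∞ η → HasCompactSupport η → tsupport η ⊆ S →
      (∫ x, partialDeriv 0 η x • U x) + Complex.I * (∫ x, partialDeriv 1 η x • U x) = 0)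
    {φ : Plane → ℝ} (hφ : ContDiff ℝ ∞ φ) (hc : HasCompactSupport φ) {y : Plane}
    (hy : ∀ t ∈ tsupport φ, y - t ∈ S) : IsCR (φ ⋆[lsmul ℝ ℝ, volume] U) y := by
  refine ⟨(contDiff_mollify hφ hc hU).differentiable (by simp) y, ?_⟩
  rw [partialC_mollify hφ hc hU, partialC_mollify hφ hc hU]
  have hsub : tsupport (fun z => φ (y - z)) ⊆ S := by
    intro z hz
    have h1 : y - z ∈ tsupport φ :=
      tsupport_comp_subset_preimage φ (f := fun z => y - z) (by fun_prop) hz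
    simpa using hy _ h1
  have := h _ (contDiff_reflect hφ y) (hasCompactSupport_reflect hc y) hsub
  simp only [partialDeriv_reflect hφ, neg_smul, integral_neg] at this
  linear_combination Complex.I * this
    + (∫ t, partialDeriv 1 φ (y - t) • U t) * Complex.I_mul_I

/-- Mollifications commute. -/
lemma mollify_mollify_comm {ρ φ : Plane → ℝ} (hρ : Continuous ρ) (hρc : HasCompactSupport ρ)
    (hφ : Continuous φ) (hφc : HasCompactSupport φ) {U : Plane → ℂ}
    (hU : LocallyIntegrable U volume) (x : Plane) :
    (ρ ⋆[lsmul ℝ ℝ, volume] (φ ⋆[lsmul ℝ ℝ, volume] U)) x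
      = (φ ⋆[lsmul ℝ ℝ, volume] (ρ ⋆[lsmul ℝ ℝ, volume] U)) x := by
  have assoc {ρ φ : Plane → ℝ} (hρ : Continuous ρ) (hρc : HasCompactSupport ρ)
      (hφ : Continuous φ) (hφc : HasCompactSupport φ) :
      ((ρ ⋆[ContinuousLinearMap.mul ℝ ℝ, volume] φ) ⋆[lsmul ℝ ℝ, volume] U) x
        = (ρ ⋆[lsmul ℝ ℝ, volume] (φ ⋆[lsmul ℝ ℝ, volume] U)) x := by
    have hn : LocallyIntegrable (fun x => ‖U x‖) volume := fun x => (hU x).norm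
    refine convolution_assoc _ _ _ _ (fun a b z => ?_) hρ.aestronglyMeasurable
      hφ.aestronglyMeasurable hU.aestronglyMeasurable ?_ ?_ ?_
    · simp [mul_assoc]
    · exact Filter.Eventually.of_forall fun y =>
        hρc.convolutionExists_left _ hρ hφ.locallyIntegrable y
    · exact Filter.Eventually.of_forall fun y =>
        hφc.norm.convolutionExists_left _ hφ.norm hn y
    · refine hρc.norm.convolutionExists_left _ hρ.norm ?_ x
      exact (hφc.norm.continuous_convolution_left _ hφ.norm hn).locallyIntegrable
  rw [← assoc hρ hρc hφ hφc, ← assoc hφ hφc hρ hρc]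
  congr 1
  rw [← convolution_flip]
  congr 1
  ext
  simp

/-- A weakly holomorphic function agrees near each point with a smooth holomorphic one. -/
lemma exists_local_holomorphic {S : Set Plane} (hS : IsOpen S) {U : Plane → ℂ}
    (hU : LocallyIntegrable U volume)
    (h : ∀ η : Plane → ℝ, ContDiff ℝ ∞ η → HasCompactSupport η → tsupport η ⊆ S →
      (∫ x, partialDeriv 0 η x • U x) + Complex.I * (∫ x, partialDeriv 1 η x • U x) = 0)
    {p : Plane} (hp : p ∈ S) : ∃ r > 0, ∃ f : Plane → ℂ, Metric.ball p r ⊆ S ∧ ContDiff ℝ ∞ f ∧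
      (∀ x ∈ Metric.ball p r, IsCR f x) ∧ ∀ᵐ x, x ∈ Metric.ball p r → U x = f x := by
  obtain ⟨s, hs, hball⟩ := Metric.isOpen_iff.mp hS p hp
  -- Four radii must fit: `x` is within `δ` of `p`, the mean value property uses a ball of radius `2
  -- * δ` about `x`, and the mollifiers reach a further `δ`.
  set δ := s / 4 with hδ
  have hδ0 : 0 < δ := by positivity
  obtain ⟨ρ, g, hρ, hts, hgc, hgz, hρg, hint⟩ := exists_radial_mollifier hδ0
  have hρc : HasCompactSupport ρ :=
    (isCompact_closedBall (0 : Plane) δ).of_isClosed_subset (isClosed_tsupport _) hts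
  have hmem {φ : Plane → ℝ} (hφ : tsupport φ ⊆ Metric.closedBall 0 δ) {y : Plane}
      (hy : y ∈ Metric.ball p (3 * δ)) : ∀ t ∈ tsupport φ, y - t ∈ S := by
    intro t ht
    refine hball ?_
    have h1 := hφ ht
    rw [mem_closedBall_zero_iff] at h1
    rw [mem_ball_iff_norm] at hy ⊢
    calc ‖y - t - p‖ = ‖(y - p) - t‖ := by congr 1; abel
      _ ≤ ‖y - p‖ + ‖t‖ := norm_sub_le _ _
      _ < s := by linarith
  refine ⟨δ, hδ0, ρ ⋆[lsmul ℝ ℝ, volume] U, (Metric.ball_subset_ball (by linarith)).trans hball,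
    contDiff_mollify hρ hρc hU, fun x hx => isCR_mollify hU h hρ hρc
      (hmem hts (Metric.ball_subset_ball (by linarith) hx)), ?_⟩
  let φ : ℕ → ContDiffBump (0 : Plane) := fun n =>
    ⟨δ / (2 * (n + 1)), δ / (n + 1), by positivity, by
      rw [div_lt_div_iff₀ (by positivity) (by positivity)]
      have : 0 < δ * (n + 1 : ℝ) := by positivity
      linarith⟩
  have hφ0 : Filter.Tendsto (fun n => (φ n).rOut) Filter.atTop (nhds 0) := by
    simpa [φ, div_eq_mul_inv] using
      (tendsto_one_div_add_atTop_nhds_zero_nat (𝕜 := ℝ)).const_mul δ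
  have hle (n : ℕ) : (φ n).rOut ≤ δ := by
    change δ / (n + 1) ≤ δ
    exact div_le_self hδ0.le (by linarith [Nat.cast_nonneg (α := ℝ) n])
  have hφs (n : ℕ) : ContDiff ℝ ∞ ((φ n).normed volume) := (φ n).contDiff_normed
  have hφc (n : ℕ) : HasCompactSupport ((φ n).normed volume) := (φ n).hasCompactSupport_normed
  have hφt (n : ℕ) : tsupport ((φ n).normed volume) ⊆ Metric.closedBall 0 δ := by
    rw [(φ n).tsupport_normed_eq]
    exact Metric.closedBall_subset_closedBall (hle n)
  -- Lebesgue differentiation. The bound `K = 2` is the ratio of outer to inner radius of every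
  -- bump.
  have hlim := ContDiffBump.ae_convolution_tendsto_right_of_locallyIntegrable (μ := volume)
    (φ := φ) (K := 2) hφ0 (Filter.Eventually.of_forall fun n => by
      change δ / (n + 1) ≤ 2 * (δ / (2 * (n + 1)))
      exact le_of_eq (by field_simp)) hU
  filter_upwards [hlim] with x hx hxp
  -- Both limits are taken along one sequence: `φₙ ⋆ (ρ ⋆ U) = ρ ⋆ (φₙ ⋆ U) = φₙ ⋆ U` at `x`,
  -- because `φₙ ⋆ U` is holomorphic near `x` and `ρ` is radial. The left side tends to `ρ ⋆ U`, the
  -- right side to `U` almost everywhere.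
  have hlim2 := ContDiffBump.convolution_tendsto_right_of_continuous (μ := volume) (φ := φ) hφ0
    (contDiff_mollify hρ hρc hU).continuous x
  refine tendsto_nhds_unique hx (hlim2.congr fun n => ?_)
  rw [← mollify_mollify_comm hρ.continuous hρc (hφs n).continuous (hφc n) hU x]
  refine mollify_eq_of_isCR (R := 2 * δ) (by linarith) (fun y hy => ?_) hgc hgz hρg hint
  refine isCR_mollify hU h (hφs n) (hφc n) (hmem (hφt n) ?_)
  rw [Metric.mem_ball] at hy hxp ⊢
  linarith [dist_triangle y x p]

/-- **Weyl's lemma** for the Cauchy–Riemann operator. -/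
theorem exists_holomorphic {S : Set Plane} (hS : IsOpen S) {U : Plane → ℂ}
    (hU : LocallyIntegrable U volume)
    (h : ∀ η : Plane → ℝ, ContDiff ℝ ∞ η → HasCompactSupport η → tsupport η ⊆ S →
      (∫ x, partialDeriv 0 η x • U x) + Complex.I * (∫ x, partialDeriv 1 η x • U x) = 0) :
    ∃ f : Plane → ℂ, (∀ x ∈ S, ContDiffAt ℝ ∞ f x) ∧ (∀ x ∈ S, IsCR f x) ∧
      ∀ᵐ x, x ∈ S → U x = f x := by
  choose! r hr F hsub hF hCR hae using
    fun p (hp : p ∈ S) => exists_local_holomorphic hS hU h hp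
  -- Two local representatives are continuous and agree almost everywhere on the overlap, hence
  -- agree there. The diagonal `z ↦ F z z` therefore coincides with `F p` near `p`.
  have hglue {p z : Plane} (hp : p ∈ S) (hz : z ∈ Metric.ball p (r p)) : F z z = F p z := by
    have hzS := hsub p hp hz
    have hopen : IsOpen (Metric.ball z (r z) ∩ Metric.ball p (r p)) :=
      Metric.isOpen_ball.inter Metric.isOpen_ball
    refine Measure.eqOn_open_of_ae_eq (μ := (volume : Measure Plane)) ?_ hopen
      (hF z hzS).continuous.continuousOn (hF p hp).continuous.continuousOn
      ⟨Metric.mem_ball_self (hr z hzS), hz⟩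
    refine (ae_restrict_iff' hopen.measurableSet).mpr ?_
    filter_upwards [hae z hzS, hae p hp] with y h1 h2 hy
    rw [← h1 hy.1, h2 hy.2]
  have hev {p : Plane} (hp : p ∈ S) : (fun z => F z z) =ᶠ[nhds p] F p := by
    filter_upwards [Metric.ball_mem_nhds p (hr p hp)] with z hz using hglue hp hz
  refine ⟨fun z => F z z, fun x hx => (hF x hx).contDiffAt.congr_of_eventuallyEq (hev hx),
    fun x hx => ?_, ?_⟩
  · obtain ⟨h1, h2⟩ := hCR x hx x (Metric.mem_ball_self (hr x hx))
    refine ⟨h1.congr_of_eventuallyEq (hev hx), ?_⟩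
    simp only [partialC, (hev hx).fderiv_eq]
    exact h2
  · have hnull : volume {x | x ∈ S ∧ U x ≠ F x x} = 0 := by
      refine measure_null_of_locally_null _ fun p hp => ?_
      refine ⟨Metric.ball p (r p) ∩ {x | x ∈ S ∧ U x ≠ F x x}, ?_, ?_⟩
      · exact Filter.inter_mem (mem_nhdsWithin_of_mem_nhds
          (Metric.ball_mem_nhds p (hr p hp.1))) self_mem_nhdsWithin
      · refine measure_mono_null ?_ (ae_iff.mp (hae p hp.1))
        rintro x ⟨hx, hxS, hne⟩
        simp only [Set.mem_ofPred_eq, not_forall]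
        exact ⟨hx, fun he => hne (he.trans (hglue hp.1 hx).symm)⟩
    rw [ae_iff]
    convert hnull using 3
    simp

/-- A function with vanishing weak gradient is constant. -/
theorem eq_const_of_hasWeakPartial_zero {Ω : PlanarDomain} {u : L2 Ω}
    (h : ∀ j, HasWeakPartial Ω j u 0) : ∃ c : ℂ, u = const Ω c := by
  have hm := Ω.isOpen.measurableSet
  have hU : LocallyIntegrable (Ω.carrier.indicator u) volume :=
    (memLp_indicator Ω u).locallyIntegrable (by norm_num)
  have hz (j : Fin 2) (η : Plane → ℝ) (hη : ContDiff ℝ ∞ η) (hc : HasCompactSupport η)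
      (hs : tsupport η ⊆ Ω.carrier) :
      ∫ x, partialDeriv j η x • Ω.carrier.indicator u x = 0 := by
    rw [integral_smul_indicator, h j η hη hc hs, integral_test_zero, neg_zero]
  -- A vanishing weak gradient satisfies the weak Cauchy–Riemann equation in particular, so Weyl's
  -- lemma supplies a smooth representative.
  obtain ⟨f, hf, -, hae⟩ := exists_holomorphic Ω.isOpen hU fun η hη hc hs => by
    rw [hz 0 η hη hc hs, hz 1 η hη hc hs, mul_zero, add_zero]
  have hfC : ContDiffOn ℝ ∞ f Ω.carrier := fun x hx => (hf x hx).contDiffWithinAt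
  have hfC1 : ContDiffOn ℝ 1 f Ω.carrier := hfC.of_le (by simp)
  have hpc (j : Fin 2) : ContinuousOn (partialC j f) Ω.carrier :=
    (hfC1.continuousOn_fderiv_of_isOpen Ω.isOpen (by simp)).clm_apply continuousOn_const
  have hpz (j : Fin 2) : ∀ x ∈ Ω.carrier, partialC j f x = 0 := by
    have h0 := Ω.isOpen.ae_eq_zero_of_integral_contDiff_smul_eq_zero (μ := volume)
      ((hpc j).locallyIntegrableOn hm) fun η hη hc hs => by
        rw [← neg_eq_zero, ← integral_partialDeriv_smul Ω.isOpen hη hc hs hfC1 j,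
          ← hz j η hη hc hs]
        refine integral_congr_ae ?_
        filter_upwards [hae] with x hx
        by_cases hxΩ : x ∈ Ω.carrier
        · rw [← hx hxΩ]
        · have : x ∉ tsupport (partialDeriv j η) := fun h' =>
            hxΩ (hs (tsupport_fderiv_apply_subset ℝ _ h'))
          simp [image_eq_zero_of_notMem_tsupport this]
    exact Measure.eqOn_open_of_ae_eq (μ := (volume : Measure Plane))
      ((ae_restrict_iff' hm).mpr h0) Ω.isOpen (hpc j) continuousOn_const
  have hfd : Set.EqOn (fderiv ℝ f) 0 Ω.carrier := fun x hx => by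
    refine ContinuousLinearMap.coe_injective
      ((EuclideanSpace.basisFun (Fin 2) ℝ).toBasis.ext fun j => ?_)
    simpa [partialC] using hpz j x hx
  obtain ⟨c, hc⟩ := Ω.isOpen.exists_is_const_of_fderiv_eq_zero Ω.isConnected.isPreconnected
    (hfC1.differentiableOn (by simp)) hfd
  refine ⟨c, Lp.ext ?_⟩
  have hconst : (const Ω c : L2 Ω) =ᵐ[Ω.vol] fun _ => c := Lp.coeFn_const 2 Ω.vol c
  filter_upwards [hconst, (ae_restrict_iff' hm).mpr (Filter.Eventually.of_forall fun x hx => hx),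
    ae_restrict_of_ae hae] with x h1 hx h2
  have := h2 hx
  rw [Set.indicator_of_mem hx] at this
  rw [h1, this, hc x hx]

/-! ### Primitives of locally exact forms -/

/-- The real numbers with the discrete topology. -/
@[ext]
structure DiscreteReal where
  /-- the underlying real number -/
  val : ℝ

/-- A discrete fibre makes the bundle of germs a covering space; the separate structure keeps this
topology apart from the usual one on `ℝ`. -/
instance : TopologicalSpace DiscreteReal := ⊥

instance : DiscreteTopology DiscreteReal := ⟨rfl⟩

section Primitive

variable {E : Type*} [NormedAddCommGroup E] [NormedSpace ℝ E]

/-- The bundle of germs of primitives of a locally exact 1-form; `F p` is a primitive near `p`. -/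
def primitiveCore {U : Set E} {w : E → E →L[ℝ] ℝ} (r : U → ℝ) (hr : ∀ p, 0 < r p) (F : U → E → ℝ)
    (hF : ∀ p : U, ∀ y ∈ Metric.ball (p : E) (r p), HasFDerivAt (F p) (w y) y) :
    FiberBundleCore U U DiscreteReal where
  baseSet p := {x | (x : E) ∈ Metric.ball (p : E) (r p)}
  isOpen_baseSet p := Metric.isOpen_ball.preimage continuous_subtype_val
  indexAt := id
  mem_baseSet_at p := Metric.mem_ball_self (hr p)
  -- The coordinate `v` in the chart of `p` stands for the germ of `F p + v`; the change of chart
  -- rewrites it relative to `F q`.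
  coordChange p q x v := ⟨v.val + (F p x - F q x)⟩
  coordChange_self p x _ v := by simp
  continuousOn_coordChange p q := by
    have hconst : ∃ c : ℝ, ∀ y ∈ Metric.ball (p : E) (r p) ∩ Metric.ball (q : E) (r q),
        F p y - F q y = c := by
      have hopen : IsOpen (Metric.ball (p : E) (r p) ∩ Metric.ball (q : E) (r q)) :=
        Metric.isOpen_ball.inter Metric.isOpen_ball
      have hd (y : E) (hy : y ∈ Metric.ball (p : E) (r p) ∩ Metric.ball (q : E) (r q)) :
          HasFDerivAt (fun y => F p y - F q y) (0 : E →L[ℝ] ℝ) y := by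
        have := (hF p y hy.1).sub (hF q y hy.2)
        rwa [sub_self] at this
      exact hopen.exists_is_const_of_fderiv_eq_zero
        ((convex_ball _ _).inter (convex_ball _ _)).isPreconnected
        (fun y hy => (hd y hy).differentiableAt.differentiableWithinAt)
        fun y hy => (hd y hy).fderiv
    obtain ⟨c, hc⟩ := hconst
    have hcont : Continuous fun z : U × DiscreteReal =>
        (⟨z.2.val + c⟩ : DiscreteReal) :=
      (continuous_of_discreteTopology (f := fun v : DiscreteReal =>
        (⟨v.val + c⟩ : DiscreteReal))).comp continuous_snd
    refine hcont.continuousOn.congr ?_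
    rintro ⟨x, v⟩ ⟨hx, -⟩
    simp only [hc x hx]
  coordChange_comp p q s x _ v := by
    ext
    simp only
    ring

/-- A locally exact 1-form on a simply connected open set is exact. -/
theorem exists_primitive_of_simplyConnected {U : Set E} (hU : IsOpen U) [SimplyConnectedSpace U]
    {w : E → E →L[ℝ] ℝ}
    (h : ∀ p ∈ U, ∃ r > 0, ∃ F : E → ℝ, ∀ y ∈ Metric.ball p r, HasFDerivAt F (w y) y) :
    ∃ F : E → ℝ, ∀ y ∈ U, HasFDerivAt F (w y) y := by
  choose r hr F hF using fun p : U => h p p.2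
  let Z := primitiveCore r hr F hF
  have hcov : IsCoveringMap (Bundle.TotalSpace.proj : Bundle.TotalSpace DiscreteReal Z.Fiber → U) :=
    FiberBundle.isCoveringMap
  have : LocallyPathConnectedSpace U := hU.locallyPathConnectedSpace
  obtain ⟨a⟩ : Nonempty U := inferInstance
  -- A lift of the identity is a continuous global choice of germs of primitives.
  obtain ⟨s, ⟨-, hs⟩, -⟩ := hcov.existsUnique_continuousMap_lifts (ContinuousMap.id U) a
    ⟨a, (⟨0⟩ : DiscreteReal)⟩ rfl
  have hs' (x : U) : (s x).1 = x := congrFun hs x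
  classical
  let c : U → DiscreteReal := fun x => (s x).2
  let P : E → ℝ := fun x => if hx : x ∈ U then
    F (s ⟨x, hx⟩).1 (s ⟨x, hx⟩).1 + (c ⟨x, hx⟩).val else 0
  refine ⟨P, fun y hy => ?_⟩
  let p : U := ⟨y, hy⟩
  -- The section read in the chart of `p`. It is continuous at `p` with discrete values, hence
  -- locally constant, so near `p` the function `P` is `F p` plus a constant.
  let v : U → DiscreteReal := fun x => (Z.localTriv p (s x)).2
  have hv : ContinuousAt v p := by
    refine continuousAt_snd.comp (ContinuousAt.comp (f := s) ?_ s.continuous.continuousAt)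
    refine (Z.localTriv p).continuousAt ?_
    change ((s p).1 : E) ∈ Metric.ball (p : E) (r p)
    rw [hs']
    exact Metric.mem_ball_self (hr p)
  have hvc : ∀ᶠ x in nhds p, v x = v p :=
    hv.eventually (p := fun z => z = v p) (by simp [nhds_discrete])
  have hP (x : U) : P x = F p x + (v x).val := by
    have h1 : P x = F (s x).1 (s x).1 + (c x).val := by simp [P]
    have h2 : (v x).val = (c x).val + (F (s x).1 (s x).1 - F p (s x).1) := rfl
    rw [h1, h2, hs' x]
    ring
  have hev : P =ᶠ[nhds y] fun x => F p x + (v p).val := by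
    have := hU.isOpenEmbedding_subtypeVal.map_nhds_eq p
    change ∀ᶠ x in nhds (p : E), _
    rw [← this, Filter.eventually_map]
    filter_upwards [hvc] with x hx
    rw [hP x, hx]
  exact ((hF p y (Metric.mem_ball_self (hr p))).add_const _).congr_of_eventuallyEq hev

end Primitive

/-! ### Tangential irrotational and solenoidal fields -/

/-- The classical partial derivative is the weak one. -/
lemma hasWeakPartial_of_contDiffOn {Ω : PlanarDomain} {j : Fin 2} {f : Plane → ℂ}
    (hf : ContDiffOn ℝ 1 f Ω.carrier) {u v : L2 Ω} (hu : u =ᵐ[Ω.vol] f)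
    (hv : v =ᵐ[Ω.vol] partialC j f) : HasWeakPartial Ω j u v := by
  intro η hη hc hs
  have h := integral_partialDeriv_smul Ω.isOpen hη hc hs hf j
  have hd : tsupport (partialDeriv j η) ⊆ Ω.carrier :=
    (tsupport_fderiv_apply_subset ℝ _).trans hs
  have hset {ζ : Plane → ℝ} (hζ : tsupport ζ ⊆ Ω.carrier) (k : Plane → ℂ) :
      ∫ x, ζ x • k x = ∫ x, ζ x • k x ∂Ω.vol := by
    refine (setIntegral_eq_integral_of_forall_compl_eq_zero fun x hx => ?_).symm
    rw [image_eq_zero_of_notMem_tsupport fun hx' => hx (hζ hx'), zero_smul]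
  rw [hset hd, hset hs] at h
  have e1 : ∫ x, partialDeriv j η x • u x ∂Ω.vol = ∫ x, partialDeriv j η x • f x ∂Ω.vol :=
    integral_congr_ae (hu.mono fun x hx => by simp only [hx])
  have e2 : ∫ x, η x • v x ∂Ω.vol = ∫ x, η x • partialC j f x ∂Ω.vol :=
    integral_congr_ae (hv.mono fun x hx => by simp only [hx])
  rw [e1, e2, h]

/-- The 1-form `Re f dx₁ - Im f dx₂`. -/
def reForm (f : Plane → ℂ) (x : Plane) : Plane →L[ℝ] ℝ :=
  (f x).re • EuclideanSpace.proj 0 - (f x).im • EuclideanSpace.proj 1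

/-- On a simply connected domain, the form `Re f dx₁ - Im f dx₂` with holomorphic `f` is exact. -/
lemma exists_primitive_reForm {S : Set Plane} (hS : IsOpen S) [SimplyConnectedSpace S]
    {f : Plane → ℂ} (hf : ∀ x ∈ S, IsCR f x) :
    ∃ h : Plane → ℝ, ∀ x ∈ S, HasFDerivAt h (reForm f x) x := by
  refine exists_primitive_of_simplyConnected hS fun p hp => ?_
  obtain ⟨r, hr, hball⟩ := Metric.isOpen_iff.mp hS p hp
  refine ⟨r, hr, ?_⟩
  have hder (x : Plane) (hx : x ∈ Metric.ball p r) : HasFDerivAt (reForm f)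
      ((Complex.reCLM.comp (fderiv ℝ f x)).smulRight (EuclideanSpace.proj 0 : Plane →L[ℝ] ℝ)
        - (Complex.imCLM.comp (fderiv ℝ f x)).smulRight
          (EuclideanSpace.proj 1 : Plane →L[ℝ] ℝ)) x := by
    have hd := (hf x (hball hx)).1.hasFDerivAt
    have h1 : HasFDerivAt (fun y => (f y).re) (Complex.reCLM.comp (fderiv ℝ f x)) x :=
      Complex.reCLM.hasFDerivAt.comp x hd
    have h2 : HasFDerivAt (fun y => (f y).im) (Complex.imCLM.comp (fderiv ℝ f x)) x :=
      Complex.imCLM.hasFDerivAt.comp x hd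
    exact (h1.smul_const (EuclideanSpace.proj 0 : Plane →L[ℝ] ℝ)).sub
      (h2.smul_const (EuclideanSpace.proj 1 : Plane →L[ℝ] ℝ))
  -- Poincaré's lemma on a ball: the symmetry of the derivative of the form is exactly the
  -- Cauchy–Riemann equation.
  refine (convex_ball p r).exists_forall_hasFDerivAt_of_fderiv_symmetric Metric.isOpen_ball
    (fun x hx => (hder x hx).differentiableAt.differentiableWithinAt) fun a ha x y => ?_
  have hCR := (hf a (hball ha)).2
  have hexp (z : Plane) : fderiv ℝ f a z = z 0 • partialC 0 f a + z 1 • partialC 1 f a := by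
    have hz : z = z 0 • EuclideanSpace.single 0 (1 : ℝ) + z 1 • EuclideanSpace.single 1 1 := by
      ext i
      fin_cases i <;> simp
    conv_lhs => rw [hz]
    rw [map_add, map_smul, map_smul]
    rfl
  rw [(hder a ha).fderiv]
  simp only [sub_apply, ContinuousLinearMap.smulRight_apply,
    ContinuousLinearMap.comp_apply, smul_apply, hexp, hCR]
  simp
  ring

/-- A real square-integrable field that is weakly irrotational, solenoidal and tangential to the
boundary of a simply connected domain vanishes. -/
lemma eq_zero_of_real_field (Ω : PlanarDomain) [SimplyConnectedSpace Ω.carrier] {A B : L2 Ω}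
    (hA : ∀ᵐ x ∂Ω.vol, (A x).im = 0) (hB : ∀ᵐ x ∂Ω.vol, (B x).im = 0)
    (hN : ∀ η : Plane → ℝ, ContDiff ℝ ∞ η → HasCompactSupport η →
      ∫ x, partialDeriv 0 η x • A x ∂Ω.vol + ∫ x, partialDeriv 1 η x • B x ∂Ω.vol = 0)
    (hR : ∀ η : Plane → ℝ, ContDiff ℝ ∞ η → HasCompactSupport η → tsupport η ⊆ Ω.carrier →
      ∫ x, partialDeriv 0 η x • B x ∂Ω.vol = ∫ x, partialDeriv 1 η x • A x ∂Ω.vol) :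
    A = 0 ∧ B = 0 := by
  have hm := Ω.isOpen.measurableSet
  -- For real `A`, `B` the function `A - i B` is weakly holomorphic exactly when the field is
  -- solenoidal and irrotational.
  set D : L2 Ω := A + (-Complex.I) • B with hD
  obtain ⟨f, hfs, hfCR, hfae⟩ := exists_holomorphic Ω.isOpen
    ((memLp_indicator Ω D).locallyIntegrable (by norm_num)) fun η hη hc hs => by
      rw [integral_smul_indicator, integral_smul_indicator, hD,
        integral_test_add Ω (continuous_partialDeriv 0 hη) (hasCompactSupport_partialDeriv 0 hc),
        integral_test_add Ω (continuous_partialDeriv 1 hη) (hasCompactSupport_partialDeriv 1 hc),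
        integral_test_smul, integral_test_smul]
      linear_combination hN η hη hc - Complex.I * hR η hη hc hs
        - (∫ x, partialDeriv 1 η x • B x ∂Ω.vol) * Complex.I_mul_I
  have hfC : ContDiffOn ℝ 1 f Ω.carrier := fun x hx =>
    ((hfs x hx).of_le (by simp)).contDiffWithinAt
  have hfA : ∀ᵐ x ∂Ω.vol, A x = (f x).re ∧ B x = (-(f x).im : ℝ) := by
    filter_upwards [hA, hB, Lp.coeFn_add A ((-Complex.I) • B), Lp.coeFn_smul (-Complex.I) B,
      ae_restrict_of_ae hfae, ae_restrict_mem hm] with x h1 h2 h3 h4 h5 hx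
    have h6 := h5 hx
    rw [Set.indicator_of_mem hx, hD, h3, Pi.add_apply, h4, Pi.smul_apply, smul_eq_mul] at h6
    rw [← h6]
    constructor <;> apply Complex.ext <;> simp [h1, h2]
  obtain ⟨h, hh⟩ := exists_primitive_reForm Ω.isOpen hfCR
  have hform : ContDiffOn ℝ 1 (reForm f) Ω.carrier :=
    ((Complex.reCLM.contDiff.comp_contDiffOn hfC).smul contDiffOn_const).sub
      ((Complex.imCLM.contDiff.comp_contDiffOn hfC).smul contDiffOn_const)
  have hhC : ContDiffOn ℝ 1 h Ω.carrier := by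
    have := (contDiffOn_succ_iff_fderiv_of_isOpen (𝕜 := ℝ) (n := 0) (f := h) Ω.isOpen).mpr
      ⟨fun x hx => (hh x hx).differentiableAt.differentiableWithinAt, by simp,
        (hform.of_le (by simp)).congr fun x hx => (hh x hx).fderiv⟩
    simpa using this
  -- The potential `h` has gradient `(A, B)` but is not known to be square-integrable. `arctan h` is
  -- bounded and its gradient is dominated by the field, so it is an admissible function for Green's
  -- formula.
  set u : Plane → ℂ := fun x => (Real.arctan (h x) : ℂ) with hu
  have huC : ContDiffOn ℝ 1 u Ω.carrier :=
    Complex.ofRealCLM.contDiff.comp_contDiffOn (Real.contDiff_arctan.comp_contDiffOn hhC)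
  have hpart (j : Fin 2) (x : Plane) (hx : x ∈ Ω.carrier) : partialC j u x
      = ((1 / (1 + h x ^ 2) * reForm f x (EuclideanSpace.single j 1) : ℝ) : ℂ) := by
    have h1 : HasFDerivAt (fun x => Real.arctan (h x)) ((1 / (1 + h x ^ 2)) • reForm f x) x :=
      (hh x hx).arctan
    have h2 := Complex.ofRealCLM.hasFDerivAt.comp x h1
    rw [partialC]
    erw [h2.fderiv]
    simp
  have h0 (x : Plane) : reForm f x (EuclideanSpace.single 0 1) = (f x).re := by simp [reForm]
  have h1 (x : Plane) : reForm f x (EuclideanSpace.single 1 1) = -(f x).im := by simp [reForm]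
  have hpc (j : Fin 2) : AEStronglyMeasurable (partialC j u) Ω.vol :=
    ((huC.continuousOn_fderiv_of_isOpen Ω.isOpen (by simp)).clm_apply
      continuousOn_const).aestronglyMeasurable hm
  have hum : MemLp u 2 Ω.vol := by
    refine MemLp.of_bound (huC.continuousOn.aestronglyMeasurable hm) (Real.pi / 2)
      (Filter.Eventually.of_forall fun x => ?_)
    rw [hu, Complex.norm_real, Real.norm_eq_abs]
    exact abs_le.mpr ⟨(Real.neg_pi_div_two_lt_arctan _).le, (Real.arctan_lt_pi_div_two _).le⟩
  have hle (x : Plane) : |1 / (1 + h x ^ 2)| ≤ 1 := by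
    rw [abs_of_pos (by positivity), div_le_one (by positivity)]
    nlinarith [sq_nonneg (h x)]
  have hbound (x : Plane) (a : ℝ) : ‖((1 / (1 + h x ^ 2) * a : ℝ) : ℂ)‖ ≤ ‖(a : ℂ)‖ := by
    rw [Complex.norm_real, Complex.norm_real, norm_mul]
    exact mul_le_of_le_one_left (norm_nonneg _) (hle x)
  have hm0 : MemLp (partialC 0 u) 2 Ω.vol := by
    refine (Lp.memLp A).of_le (hpc 0) ?_
    filter_upwards [hfA, ae_restrict_mem hm] with x hx hxΩ
    rw [hpart 0 x hxΩ, hx.1, h0]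
    exact hbound x _
  have hm1 : MemLp (partialC 1 u) 2 Ω.vol := by
    refine (Lp.memLp B).of_le (hpc 1) ?_
    filter_upwards [hfA, ae_restrict_mem hm] with x hx hxΩ
    rw [hpart 1 x hxΩ, hx.2, h1]
    exact hbound x _
  -- By `hN` the field annihilates all gradients of test functions, hence `∇(arctan h)`. The
  -- integrand is then `|∇h|² / (1 + h²)`, which is nonnegative and must vanish.
  have key := integral_green
    (hasWeakPartial_of_contDiffOn huC hum.coeFn_toLp hm0.coeFn_toLp)
    (hasWeakPartial_of_contDiffOn huC hum.coeFn_toLp hm1.coeFn_toLp)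
    (g₀ := 0) (g₁ := A) (g₂ := B) fun η hη hc => by
      rw [integral_test_zero, zero_add, hN η hη hc]
  set q : Plane → ℝ := fun x => 1 / (1 + h x ^ 2) * ((f x).re ^ 2 + (f x).im ^ 2) with hq
  have hqeq : (fun x => (0 : L2 Ω) x * hum.toLp u x + A x * hm0.toLp (partialC 0 u) x
      + B x * hm1.toLp (partialC 1 u) x) =ᵐ[Ω.vol] fun x => (q x : ℂ) := by
    filter_upwards [Lp.coeFn_zero ℂ 2 Ω.vol, hm0.coeFn_toLp, hm1.coeFn_toLp, hfA,
      ae_restrict_mem hm] with x e0 e1 e2 e3 hx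
    rw [e0, e1, e2, e3.1, e3.2, hpart 0 x hx, hpart 1 x hx, h0, h1, hq]
    simp only [Pi.zero_apply]
    push_cast
    ring
  have hqi : Integrable (fun x => (q x : ℂ)) Ω.vol := by
    refine Integrable.congr ?_ hqeq
    exact (((Lp.memLp (0 : L2 Ω)).integrable_mul (Lp.memLp (hum.toLp u))).add
      ((Lp.memLp A).integrable_mul (Lp.memLp (hm0.toLp _)))).add
      ((Lp.memLp B).integrable_mul (Lp.memLp (hm1.toLp _)))
  have hqi' : Integrable q Ω.vol := by simpa using hqi.re
  rw [integral_congr_ae hqeq, integral_complex_ofReal, Complex.ofReal_eq_zero,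
    integral_eq_zero_iff_of_nonneg (fun x => by simp only [hq]; positivity) hqi'] at key
  have hfz : ∀ᵐ x ∂Ω.vol, (f x).re = 0 ∧ (f x).im = 0 := by
    filter_upwards [key] with x hx
    have hpos : (0 : ℝ) < 1 / (1 + h x ^ 2) := by positivity
    have hs : (f x).re ^ 2 + (f x).im ^ 2 = 0 :=
      (mul_eq_zero.mp hx).resolve_left hpos.ne'
    constructor <;> nlinarith [sq_nonneg (f x).re, sq_nonneg (f x).im]
  constructor <;> rw [Lp.eq_zero_iff_ae_eq_zero]
  · filter_upwards [hfA, hfz] with x e1 e2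
    simp [e1.1, e2.1]
  · filter_upwards [hfA, hfz] with x e1 e2
    simp [e1.2, e2.2]

/-- The real part of a function in `L²(Ω)`. -/
def reL2 {Ω : PlanarDomain} (u : L2 Ω) : L2 Ω :=
  (Lp.memLp u).re.ofReal.toLp (fun x => (((u x).re : ℝ) : ℂ))

lemma coeFn_reL2 {Ω : PlanarDomain} (u : L2 Ω) : reL2 u =ᵐ[Ω.vol] fun x => ((u x).re : ℂ) :=
  MemLp.coeFn_toLp _

lemma integral_test_reL2 {Ω : PlanarDomain} {ζ : Plane → ℝ} (hζ : Continuous ζ)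
    (hc : HasCompactSupport ζ) (u : L2 Ω) :
    ∫ x, ζ x • reL2 u x ∂Ω.vol = ((∫ x, ζ x • u x ∂Ω.vol).re : ℂ) := by
  have h := Complex.reCLM.integral_comp_comm (integrable_test Ω hζ hc u)
  simp only [Complex.reCLM_apply] at h
  rw [← h, ← integral_complex_ofReal]
  refine integral_congr_ae ?_
  filter_upwards [coeFn_reL2 u] with x hx
  simp [hx]

/-- A square-integrable field that is weakly irrotational, solenoidal and tangential to the
boundary of a simply connected domain vanishes. -/
theorem eq_zero_of_irrotational_tangential (Ω : PlanarDomain) [SimplyConnectedSpace Ω.carrier]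
    {A B : L2 Ω}
    (hN : ∀ η : Plane → ℝ, ContDiff ℝ ∞ η → HasCompactSupport η →
      ∫ x, partialDeriv 0 η x • A x ∂Ω.vol + ∫ x, partialDeriv 1 η x • B x ∂Ω.vol = 0)
    (hR : ∀ η : Plane → ℝ, ContDiff ℝ ∞ η → HasCompactSupport η → tsupport η ⊆ Ω.carrier →
      ∫ x, partialDeriv 0 η x • B x ∂Ω.vol = ∫ x, partialDeriv 1 η x • A x ∂Ω.vol) :
    A = 0 ∧ B = 0 := by
  have hre (u : L2 Ω) : ∀ᵐ x ∂Ω.vol, (reL2 u x).im = 0 := by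
    filter_upwards [coeFn_reL2 u] with x hx
    rw [hx, Complex.ofReal_im]
  -- Both hypotheses pass to real parts because the test functions are real. The factors `c = 1` and
  -- `c = i` recover the real part and minus the imaginary part.
  have hmain (c : ℂ) : reL2 (c • A) = 0 ∧ reL2 (c • B) = 0 := by
    refine eq_zero_of_real_field Ω (hre _) (hre _) (fun η hη hc => ?_) (fun η hη hc hs => ?_)
    all_goals
      rw [integral_test_reL2 (continuous_partialDeriv 0 hη) (hasCompactSupport_partialDeriv 0 hc),
        integral_test_reL2 (continuous_partialDeriv 1 hη) (hasCompactSupport_partialDeriv 1 hc),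
        integral_test_smul, integral_test_smul]
    · rw [← Complex.ofReal_add, ← Complex.add_re, ← mul_add, hN η hη hc]
      simp
    · rw [hR η hη hc hs]
  have hz {u : L2 Ω} (h1 : reL2 ((1 : ℂ) • u) = 0) (h2 : reL2 (Complex.I • u) = 0) : u = 0 := by
    rw [Lp.eq_zero_iff_ae_eq_zero] at h1 h2 ⊢
    filter_upwards [h1, h2, coeFn_reL2 ((1 : ℂ) • u), coeFn_reL2 (Complex.I • u),
      Lp.coeFn_smul Complex.I u] with x e1 e2 e3 e4 e5
    rw [e3] at e1
    rw [e4, e5] at e2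
    simp only [one_smul] at e1
    apply Complex.ext
    · simpa using e1
    · simpa using e2
  exact ⟨hz (hmain 1).1 (hmain Complex.I).1, hz (hmain 1).2 (hmain Complex.I).2⟩

/-! ### Energy identities and the first order system -/

lemma hasWeakPartial_star {Ω : PlanarDomain} {j : Fin 2} {u v : L2 Ω}
    (h : HasWeakPartial Ω j u v) : HasWeakPartial Ω j (star u) (star v) := by
  intro η hη hc hs
  have hstar (ζ : Plane → ℝ) (w : L2 Ω) :
      ∫ x, ζ x • (star w : L2 Ω) x ∂Ω.vol = conj (∫ x, ζ x • w x ∂Ω.vol) := by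
    rw [← integral_conj]
    refine integral_congr_ae ?_
    filter_upwards [Lp.coeFn_star w] with x hx
    simp [hx]
  rw [hstar, hstar, h η hη hc hs, map_neg]

/-- The Hermitian form of `integral_green`. -/
theorem inner_green {Ω : PlanarDomain} {u u₀ u₁ : L2 Ω} (hu₀ : HasWeakPartial Ω 0 u u₀)
    (hu₁ : HasWeakPartial Ω 1 u u₁) {g₀ g₁ g₂ : L2 Ω}
    (hg : ∀ η : Plane → ℝ, ContDiff ℝ ∞ η → HasCompactSupport η →
      ∫ x, η x • g₀ x ∂Ω.vol + ∫ x, partialDeriv 0 η x • g₁ x ∂Ω.vol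
        + ∫ x, partialDeriv 1 η x • g₂ x ∂Ω.vol = 0) :
    ⟪u, g₀⟫_ℂ + ⟪u₀, g₁⟫_ℂ + ⟪u₁, g₂⟫_ℂ = 0 := by
  have h := integral_green (hasWeakPartial_star hu₀) (hasWeakPartial_star hu₁) hg
  rw [L2.inner_def, L2.inner_def, L2.inner_def, ← integral_add_add (L2.integrable_inner _ _)
    (L2.integrable_inner _ _) (L2.integrable_inner _ _), ← h]
  refine integral_congr_ae ?_
  filter_upwards [Lp.coeFn_star u, Lp.coeFn_star u₀, Lp.coeFn_star u₁] with x h1 h2 h3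
  simp [h1, h2, h3]

lemma contDiff_partialDeriv (j : Fin 2) {η : Plane → ℝ} (hη : ContDiff ℝ ∞ η) :
    ContDiff ℝ ∞ (partialDeriv j η) :=
  (hη.fderiv_right (m := ∞) (by simp)).clm_apply contDiff_const

lemma partialDeriv_comm {η : Plane → ℝ} (hη : ContDiff ℝ ∞ η) (i j : Fin 2) (x : Plane) :
    partialDeriv i (partialDeriv j η) x = partialDeriv j (partialDeriv i η) x := by
  have hd : Differentiable ℝ (fderiv ℝ η) :=
    (hη.fderiv_right (m := ∞) (by simp)).differentiable (by simp)
  have hex (i j : Fin 2) : partialDeriv i (partialDeriv j η) x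
      = fderiv ℝ (fderiv ℝ η) x (EuclideanSpace.single i 1) (EuclideanSpace.single j 1) := by
    have h := ((hd x).hasFDerivAt.clm_apply
      (hasFDerivAt_const (EuclideanSpace.single j (1 : ℝ) : Plane) x)).fderiv
    rw [partialDeriv]
    erw [h]
    simp
  rw [hex, hex]
  exact (hη.contDiffAt.isSymmSndFDerivAt (by simpa using ENat.LEInfty.out)).eq _ _

section Sobolev

variable {Ω : PlanarDomain} {l : ℕ+}

/-- A gradient with zero trace is orthogonal to all rotated gradients. -/
lemma inner_rot_grad {p q : L2 Ω} (hp : TraceZero Ω p) (hq : q ∈ sobolev Ω l) :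
    ⟪weakPartial Ω 1 q, weakPartial Ω 0 p⟫_ℂ = ⟪weakPartial Ω 0 q, weakPartial Ω 1 p⟫_ℂ := by
  have h := inner_green (hasWeakPartial_of_mem hq 0) (hasWeakPartial_of_mem hq 1)
    (g₀ := 0) (g₁ := (-1 : ℂ) • weakPartial Ω 1 p) (g₂ := weakPartial Ω 0 p)
    fun η hη hc => by
      -- The trace condition is tested with `∂₁ η` and `∂₀ η`; the terms with mixed second
      -- derivatives of `η` cancel in the difference.
      have h0 := hp _ (contDiff_partialDeriv 1 hη) (hasCompactSupport_partialDeriv 1 hc) 0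
      have h1 := hp _ (contDiff_partialDeriv 0 hη) (hasCompactSupport_partialDeriv 0 hc) 1
      simp only [boundaryPairing, partialDeriv_comm hη 0 1] at h0 h1
      rw [integral_test_zero, integral_test_smul]
      linear_combination h0 - h1
  rw [inner_zero_right, inner_smul_right] at h
  linear_combination h

/-- Integration by parts when one factor has zero trace. -/
lemma inner_weakPartial_of_traceZero {p q : L2 Ω} (hp : TraceZero Ω p) (hq : q ∈ sobolev Ω l)
    (j : Fin 2) : ⟪q, weakPartial Ω j p⟫_ℂ = -⟪weakPartial Ω j q, p⟫_ℂ := by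
  fin_cases j
  · have h := inner_green (hasWeakPartial_of_mem hq 0) (hasWeakPartial_of_mem hq 1)
      (g₀ := weakPartial Ω 0 p) (g₁ := p) (g₂ := 0) fun η hη hc => by
        rw [integral_test_zero, add_zero]
        exact hp η hη hc 0
    rw [inner_zero_right] at h
    simp only [Fin.zero_eta]
    linear_combination h
  · have h := inner_green (hasWeakPartial_of_mem hq 0) (hasWeakPartial_of_mem hq 1)
      (g₀ := weakPartial Ω 1 p) (g₁ := 0) (g₂ := p) fun η hη hc => by
        rw [integral_test_zero, add_zero]
        exact hp η hη hc 1
    rw [inner_zero_right] at h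
    simp only [Fin.mk_one]
    linear_combination h

/-- Green's formula for the rotation of a field with vanishing tangential component. -/
lemma inner_rot {u A B : L2 Ω} (hu : u ∈ sobolev Ω l)
    (h : ∀ η : Plane → ℝ, ContDiff ℝ ∞ η → HasCompactSupport η →
      boundaryPairing Ω 0 B η - boundaryPairing Ω 1 A η = 0) :
    ⟪u, weakPartial Ω 0 B - weakPartial Ω 1 A⟫_ℂ + ⟪weakPartial Ω 0 u, B⟫_ℂ
      - ⟪weakPartial Ω 1 u, A⟫_ℂ = 0 := by
  have h' := inner_green (hasWeakPartial_of_mem hu 0) (hasWeakPartial_of_mem hu 1)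
    (g₀ := weakPartial Ω 0 B + (-1 : ℂ) • weakPartial Ω 1 A) (g₁ := B) (g₂ := (-1 : ℂ) • A)
    fun η hη hc => by
      rw [integral_test_add Ω hη.continuous hc, integral_test_smul, integral_test_smul]
      have := h η hη hc
      simp only [boundaryPairing] at this
      linear_combination this
  rw [inner_add_right, inner_smul_right, inner_smul_right] at h'
  rw [inner_sub_right]
  linear_combination h'

lemma coeFn_const (Ω : PlanarDomain) (c : ℂ) : const Ω c =ᵐ[Ω.vol] fun _ => c :=
  Lp.coeFn_const 2 Ω.vol c

lemma vol_ne_zero (Ω : PlanarDomain) : Ω.vol.real Set.univ ≠ 0 := by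
  rw [measureReal_restrict_apply_univ]
  exact (ENNReal.toReal_pos (Ω.isOpen.measure_pos volume Ω.isConnected.nonempty).ne'
    Ω.isBounded.measure_lt_top.ne).ne'

lemma const_eq_zero_iff {c : ℂ} : const Ω c = 0 ↔ c = 0 := by
  refine ⟨fun h => ?_, fun h => by
    rw [h]
    exact map_zero (Lp.constL (p := 2) (μ := Ω.vol) (𝕜 := ℂ))⟩
  have h0 : ∀ᵐ x ∂Ω.vol, c = 0 := by
    filter_upwards [coeFn_const Ω c, (Lp.eq_zero_iff_ae_eq_zero).mp h] with x h1 h2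
    rw [← h1, h2, Pi.zero_apply]
  by_contra hc
  have hz : Ω.vol Set.univ = 0 := by simpa [hc] using ae_iff.mp h0
  exact vol_ne_zero Ω (by simp [Measure.real, hz])

/-- There is a test function with `∂₁ η = 1` on a given bounded domain. -/
lemma exists_partialDeriv_eq_one (Ω : PlanarDomain) : ∃ η : Plane → ℝ, ContDiff ℝ ∞ η ∧
    HasCompactSupport η ∧ ∀ x ∈ Ω.carrier, partialDeriv 0 η x = 1 := by
  obtain ⟨R, hR, hball⟩ := Ω.isBounded.subset_ball_lt 0 (0 : Plane)
  let φ : ContDiffBump (0 : Plane) := ⟨R, R + 1, hR, by linarith⟩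
  have hlin : ContDiff ℝ ∞ fun x : Plane => x 0 :=
    (EuclideanSpace.proj 0 : Plane →L[ℝ] ℝ).contDiff
  refine ⟨fun x => φ x * x 0, φ.contDiff.mul hlin, φ.hasCompactSupport.mul_right, fun x hx => ?_⟩
  have hev : (fun x => φ x * x 0) =ᶠ[nhds x] fun x : Plane => x 0 := by
    filter_upwards [Metric.isOpen_ball.mem_nhds (hball hx)] with y hy
    rw [φ.one_of_mem_closedBall (Metric.ball_subset_closedBall hy), one_mul]
  rw [partialDeriv, hev.fderiv_eq]
  have : fderiv ℝ (fun x : Plane => x 0) x = EuclideanSpace.proj 0 :=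
    (EuclideanSpace.proj 0 : Plane →L[ℝ] ℝ).fderiv
  rw [this]
  simp

/-- A function with zero trace and zero gradient vanishes. -/
lemma eq_zero_of_traceZero {p : L2 Ω} (hp : TraceZero Ω p) (hps : p ∈ sobolev Ω l)
    (h0 : weakPartial Ω 0 p = 0) (h1 : weakPartial Ω 1 p = 0) : p = 0 := by
  obtain ⟨c, rfl⟩ := eq_const_of_hasWeakPartial_zero (u := p) fun j => by
    have := hasWeakPartial_of_mem hps j
    fin_cases j
    · simpa [h0] using this
    · simpa [h1] using this
  -- For this `η` the trace condition on a constant `c` reads `c |Ω| = 0`.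
  obtain ⟨η, hη, hc, hone⟩ := exists_partialDeriv_eq_one Ω
  have h := hp η hη hc 0
  rw [boundaryPairing, h0, integral_test_zero, zero_add] at h
  have h2 : ∫ x, partialDeriv 0 η x • const Ω c x ∂Ω.vol = ∫ _, c ∂Ω.vol := by
    refine integral_congr_ae ?_
    filter_upwards [coeFn_const Ω c, ae_restrict_mem Ω.isOpen.measurableSet] with x hx hxΩ
    rw [hx, hone x hxΩ, one_smul]
  rw [h2, integral_const] at h
  rw [(smul_eq_zero.mp h).resolve_left (vol_ne_zero Ω)]
  exact const_eq_zero_iff.mpr rfl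

lemma hasWeakPartial_const (Ω : PlanarDomain) (c : ℂ) (j : Fin 2) :
    HasWeakPartial Ω j (const Ω c) 0 := by
  refine hasWeakPartial_of_contDiffOn (f := fun _ => c) contDiffOn_const (coeFn_const Ω c) ?_
  filter_upwards [Lp.coeFn_zero ℂ 2 Ω.vol] with x hx
  rw [hx]
  simp [partialC]

lemma const_mem_sobolev (Ω : PlanarDomain) (c : ℂ) (n : ℕ) : const Ω c ∈ sobolev Ω n := by
  cases n with
  | zero => exact Submodule.mem_top
  | succ n => exact fun j => ⟨0, zero_mem _, hasWeakPartial_const Ω c j⟩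

/-- The first order system, in terms of plane derivatives. -/
lemma field_eq_const (hΩ : SimplyConnectedSpace Ω.carrier) {φ ψ : Fin 3 → L2 Ω} {α β : L2 Ω}
    (hφ : ∀ i, φ i ∈ sobolev Ω l) (hα : α ∈ sobolev Ω l) (hψ : ∀ i, ψ i ∈ sobolev Ω l)
    (hβ : β ∈ sobolev Ω l) (hφτ : TangentialZero Ω φ) (hψν : NormalZero Ω ψ)
    (hβ0 : TraceZero Ω β) {K s : ℂ} (hs : s * s = 1)
    (e1 : weakPartial Ω 1 (ψ 2) + weakPartial Ω 0 β = -(K • (φ 0 - s • ψ 1)))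
    (e2 : -weakPartial Ω 0 (ψ 2) + weakPartial Ω 1 β = -(K • (φ 1 + s • ψ 0)))
    (e3 : weakPartial Ω 0 (ψ 1) - weakPartial Ω 1 (ψ 0) = -(K • (φ 2 + s • β)))
    (e4 : weakPartial Ω 0 (ψ 0) + weakPartial Ω 1 (ψ 1) = K • (α - s • ψ 2))
    (e5 : weakPartial Ω 1 (φ 2) + weakPartial Ω 0 α = (K * s) • (φ 1 + s • ψ 0))
    (e6 : -weakPartial Ω 0 (φ 2) + weakPartial Ω 1 α = -((K * s) • (φ 0 - s • ψ 1)))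
    (e7 : weakPartial Ω 0 (φ 1) - weakPartial Ω 1 (φ 0) = -((K * s) • (α - s • ψ 2)))
    (e8 : weakPartial Ω 0 (φ 0) + weakPartial Ω 1 (φ 1) = -((K * s) • (φ 2 + s • β))) :
    φ = 0 ∧ (∃ a, α = const Ω a) ∧ (∃ b, ψ = ![0, 0, const Ω b]) ∧ β = 0 ∧
      K • (α - s • ψ 2) = 0 := by
  have hadd {u v : L2 Ω} (c : ℂ) (hu : u ∈ sobolev Ω l) (hv : v ∈ sobolev Ω l) (j : Fin 2) :
      weakPartial Ω j (u + c • v) = weakPartial Ω j u + c • weakPartial Ω j v := by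
    rw [weakPartial_add hu (Submodule.smul_mem _ c hv), weakPartial_smul c hv]
  have hnorm {x y : L2 Ω} (h : ⟪x, x⟫_ℂ + ⟪y, y⟫_ℂ = 0) : x = 0 ∧ y = 0 := by
    have h' := congrArg RCLike.re h
    rw [map_add, inner_self_eq_norm_sq, inner_self_eq_norm_sq, map_zero] at h'
    constructor <;> rw [← norm_eq_zero] <;> nlinarith [sq_nonneg ‖x‖, sq_nonneg ‖y‖]
  -- The pair `(p, q)` decouples from the rest: `e1`, `e2`, `e5`, `e6` combine to the Cauchy–Riemann
  -- system, because `s * s = 1` is built into their right-hand sides.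
  set p := φ 2 + s • β with hp
  set q := α + (-s) • ψ 2 with hq
  have hqsub : α - s • ψ 2 = q := by rw [hq]; module
  have hps : p ∈ sobolev Ω l := add_mem (hφ 2) (Submodule.smul_mem _ s hβ)
  have hqs : q ∈ sobolev Ω l := add_mem hα (Submodule.smul_mem _ (-s) (hψ 2))
  have hp0 : TraceZero Ω p := by
    intro η hη hc j
    rw [hp, boundaryPairing_add (hφ 2) (Submodule.smul_mem _ s hβ) j hη hc,
      boundaryPairing_smul s hβ, hβ0 η hη hc j]
    obtain ⟨t1, t0, -⟩ := hφτ η hη hc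
    fin_cases j
    · simpa using t0
    · simpa using t1
  have hpq0 : weakPartial Ω 0 p = weakPartial Ω 1 q := by
    rw [hp, hq, hadd s (hφ 2) hβ, hadd (-s) hα (hψ 2)]
    linear_combination (norm := module) s • e1 - e6
  have hpq1 : weakPartial Ω 1 p = -weakPartial Ω 0 q := by
    rw [hp, hq, hadd s (hφ 2) hβ, hadd (-s) hα (hψ 2)]
    linear_combination (norm := module) s • e2 + e5
  -- After substituting the Cauchy–Riemann equations this identity says `‖∂₀ p‖² = -‖∂₁ p‖²`.
  have hDp := inner_rot_grad hp0 hqs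
  rw [← hpq0, ← neg_eq_iff_eq_neg.mpr hpq1, inner_neg_left] at hDp
  obtain ⟨hp_0, hp_1⟩ := hnorm (x := weakPartial Ω 0 p) (y := weakPartial Ω 1 p)
    (by linear_combination hDp)
  have hpz : p = 0 := eq_zero_of_traceZero hp0 hps hp_0 hp_1
  have hq_1 : weakPartial Ω 1 q = 0 := by rw [← hpq0, hp_0]
  have hq_0 : weakPartial Ω 0 q = 0 := by rw [← neg_eq_zero, ← hpq1, hp_1]
  -- Since `∇q = 0` and `φ` has no tangential component, Green's formula makes `q` orthogonal to
  -- `rot φ`, which by `e7` is a multiple of `q`.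
  have hKq : K • q = 0 := by
    have h := inner_rot hqs fun η hη hc => (hφτ η hη hc).2.2
    rw [hq_0, hq_1, inner_zero_left, inner_zero_left, e7, hqsub, inner_neg_right,
      inner_smul_right] at h
    have h' : K * ⟪q, q⟫_ℂ = 0 := by
      linear_combination (-s) * h - K * ⟪q, q⟫_ℂ * hs
    rcases mul_eq_zero.mp h' with h0 | h0
    · rw [h0, zero_smul]
    · rw [inner_self_eq_zero.mp h0, smul_zero]
  have hKsq : (K * s) • q = 0 := by rw [mul_comm, mul_smul, hKq, smul_zero]
  rw [hpz, smul_zero, neg_zero] at e3 e8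
  rw [hqsub, hKq] at e4
  rw [hqsub, hKsq, neg_zero] at e7
  -- With `p = 0` and `K q = 0`, the equations `e3`, `e4`, `e7`, `e8` are homogeneous and make `χ`
  -- free of divergence and rotation.
  set χ₀ := φ 0 + (-s) • ψ 1 with hχ₀
  set χ₁ := φ 1 + s • ψ 0 with hχ₁
  have hχsub : φ 0 - s • ψ 1 = χ₀ := by rw [hχ₀]; module
  rw [hχsub] at e1
  have hχ₀s : χ₀ ∈ sobolev Ω l := add_mem (hφ 0) (Submodule.smul_mem _ (-s) (hψ 1))
  have hχ₁s : χ₁ ∈ sobolev Ω l := add_mem (hφ 1) (Submodule.smul_mem _ s (hψ 0))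
  have hdiv : weakPartial Ω 0 χ₀ + weakPartial Ω 1 χ₁ = 0 := by
    rw [hχ₀, hχ₁, hadd (-s) (hφ 0) (hψ 1), hadd s (hφ 1) (hψ 0)]
    linear_combination (norm := module) e8 - s • e3
  have hrot : weakPartial Ω 0 χ₁ - weakPartial Ω 1 χ₀ = 0 := by
    rw [hχ₀, hχ₁, hadd (-s) (hφ 0) (hψ 1), hadd s (hφ 1) (hψ 0)]
    linear_combination (norm := module) e7 + s • e4
  -- Pair `e1`, `e2` with `∇β`: because `β` has zero trace, `∇β` is orthogonal to the rotated
  -- gradient of `ψ 2` and to the solenoidal field `χ`.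
  have hβD : weakPartial Ω 0 β = 0 ∧ weakPartial Ω 1 β = 0 := by
    apply hnorm
    have i0 := inner_weakPartial_of_traceZero hβ0 hχ₀s 0
    have i1 := inner_weakPartial_of_traceZero hβ0 hχ₁s 1
    have i2 := inner_rot_grad hβ0 (hψ 2)
    have i3 : ⟪weakPartial Ω 0 χ₀, β⟫_ℂ + ⟪weakPartial Ω 1 χ₁, β⟫_ℂ = 0 := by
      rw [← inner_add_left, hdiv, inner_zero_left]
    have j0 := congrArg (fun z => ⟪z, weakPartial Ω 0 β⟫_ℂ) e1
    have j1 := congrArg (fun z => ⟪z, weakPartial Ω 1 β⟫_ℂ) e2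
    simp only [inner_add_left, inner_neg_left, inner_smul_left] at j0 j1
    linear_combination j0 + j1 - i2 - conj K * (i0 + i1 - i3)
  have hβz : β = 0 := eq_zero_of_traceZero hβ0 hβ hβD.1 hβD.2
  have hφ2 : φ 2 = 0 := by
    have : φ 2 = p - s • β := by rw [hp]; module
    rw [this, hpz, hβz, smul_zero, sub_zero]
  rw [hβD.1, add_zero] at e1
  rw [hβD.2, add_zero] at e2
  have hψ2 : weakPartial Ω 0 (ψ 2) = 0 ∧ weakPartial Ω 1 (ψ 2) = 0 := by
    apply hnorm
    -- The tangential component of `χ` is that of `φ` plus `s` times the normal component of `ψ`, so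
    -- both boundary conditions enter. Hence `χ` is orthogonal to the rotated gradient of `ψ 2`,
    -- which is itself a multiple of `χ`.
    have h := inner_rot (A := χ₀) (B := χ₁) (hψ 2) fun η hη hc => by
      rw [hχ₀, hχ₁, boundaryPairing_add (hφ 1) (Submodule.smul_mem _ s (hψ 0)) 0 hη hc,
        boundaryPairing_add (hφ 0) (Submodule.smul_mem _ (-s) (hψ 1)) 1 hη hc,
        boundaryPairing_smul s (hψ 0), boundaryPairing_smul (-s) (hψ 1)]
      linear_combination (hφτ η hη hc).2.2 + s * hψν η hη hc
    rw [hrot, inner_zero_right, zero_add] at h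
    have j0 := congrArg (fun z => ⟪weakPartial Ω 0 (ψ 2), z⟫_ℂ) e2
    have j1 := congrArg (fun z => ⟪weakPartial Ω 1 (ψ 2), z⟫_ℂ) e1
    simp only [inner_neg_right, inner_smul_right] at j0 j1
    linear_combination K * h - j0 + j1
  have hαD (j : Fin 2) : weakPartial Ω j α = 0 := by
    have hα' : weakPartial Ω j q = weakPartial Ω j α + (-s) • weakPartial Ω j (ψ 2) :=
      hadd (-s) hα (hψ 2) j
    fin_cases j
    · simpa [hψ2.1, hq_0] using hα'.symm
    · simpa [hψ2.2, hq_1] using hα'.symm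
  have hψD (j : Fin 2) : weakPartial Ω j (ψ 2) = 0 := by
    fin_cases j
    · exact hψ2.1
    · exact hψ2.2
  obtain ⟨a, ha⟩ := eq_const_of_hasWeakPartial_zero (u := α) fun j => by
    simpa [hαD j] using hasWeakPartial_of_mem hα j
  obtain ⟨b, hb⟩ := eq_const_of_hasWeakPartial_zero (u := ψ 2) fun j => by
    simpa [hψD j] using hasWeakPartial_of_mem (hψ 2) j
  have hψz : ψ 0 = 0 ∧ ψ 1 = 0 := by
    refine eq_zero_of_irrotational_tangential Ω (fun η hη hc => ?_) (fun η hη hc hs' => ?_)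
    · have h := hψν η hη hc
      simp only [boundaryPairing] at h
      have h4 := congrArg (fun z : L2 Ω => ∫ x, η x • z x ∂Ω.vol) e4
      simp only [integral_test_add Ω hη.continuous hc, integral_test_zero] at h4
      linear_combination h - h4
    · rw [hasWeakPartial_of_mem (hψ 1) 0 η hη hc hs', hasWeakPartial_of_mem (hψ 0) 1 η hη hc hs',
        sub_eq_zero.mp e3]
  -- A quarter turn, `(φ 1, -φ 0)`, exchanges divergence with rotation and the tangential condition
  -- with the normal one.
  have hφz : φ 1 = 0 ∧ (-1 : ℂ) • φ 0 = 0 := by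
    refine eq_zero_of_irrotational_tangential Ω (fun η hη hc => ?_) (fun η hη hc hs' => ?_)
    · have h := (hφτ η hη hc).2.2
      simp only [boundaryPairing] at h
      rw [sub_eq_zero.mp e7] at h
      rw [integral_test_smul]
      linear_combination h
    · rw [integral_test_smul, hasWeakPartial_of_mem (hφ 0) 0 η hη hc hs',
        hasWeakPartial_of_mem (hφ 1) 1 η hη hc hs']
      have h8 := congrArg (fun z : L2 Ω => ∫ x, η x • z x ∂Ω.vol) e8
      simp only [integral_test_add Ω hη.continuous hc, integral_test_zero] at h8
      linear_combination h8
  refine ⟨?_, ⟨a, ha⟩, ⟨b, ?_⟩, hβz, by rw [hqsub, hKq]⟩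
  · funext i
    fin_cases i
    · simpa using hφz.2
    · exact hφz.1
    · exact hφ2
  · funext i
    fin_cases i
    · exact hψz.1
    · exact hψz.2
    · exact hb

end Sobolev

/-! ### Constant vectors and the eigenspaces -/

lemma weakPartial_const (Ω : PlanarDomain) (c : ℂ) (j : Fin 2) :
    weakPartial Ω j (const Ω c) = 0 :=
  (hasWeakPartial_const Ω c j).weakPartial_eq

lemma const_smul_eq (Ω : PlanarDomain) (c d : ℂ) : const Ω (c * d) = c • const Ω d :=
  map_smul (Lp.constL (p := 2) (μ := Ω.vol) (𝕜 := ℂ)) c d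

lemma const_zero (Ω : PlanarDomain) : const Ω 0 = 0 := const_eq_zero_iff.mpr rfl

lemma const_sub (Ω : PlanarDomain) (c d : ℂ) : const Ω (c - d) = const Ω c - const Ω d :=
  map_sub (Lp.constL (p := 2) (μ := Ω.vol) (𝕜 := ℂ)) c d

lemma constVec_mem_DH (Ω : PlanarDomain) (l : ℕ+) (a b : ℂ) : constVec Ω a b ∈ DH Ω l := by
  refine ⟨fun i => zero_mem _, const_mem_sobolev Ω a l, fun i => ?_, zero_mem _,
    fun η _ _ => ?_, fun η _ _ => ?_, fun η _ _ j => ?_⟩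
  · fin_cases i
    · exact zero_mem _
    · exact zero_mem _
    · exact const_mem_sobolev Ω b l
  all_goals simp [constVec, boundaryPairing_zero]

/-- The components of the equation `𝔄(ev, k) Φ = 0`. -/
lemma pencilFun_eq_zero_iff {Ω : PlanarDomain} {k : ℝ} {ev : ℂ} {φ ψ : Fin 3 → L2 Ω}
    {α β : L2 Ω} : pencilFun Ω k ev (φ, α, ψ, β) = 0 ↔
      (Complex.I • (weakPartial Ω 1 (ψ 2) - (Complex.I * ev) • ψ 1)
          + Complex.I • weakPartial Ω 0 β - (k : ℂ) • φ 0 = 0 ∧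
        Complex.I • ((Complex.I * ev) • ψ 0 - weakPartial Ω 0 (ψ 2))
          + Complex.I • weakPartial Ω 1 β - (k : ℂ) • φ 1 = 0 ∧
        Complex.I • (weakPartial Ω 0 (ψ 1) - weakPartial Ω 1 (ψ 0))
          + Complex.I • (Complex.I * ev) • β - (k : ℂ) • φ 2 = 0) ∧
      -(Complex.I • (weakPartial Ω 0 (ψ 0) + weakPartial Ω 1 (ψ 1) + (Complex.I * ev) • ψ 2))
          - (k : ℂ) • α = 0 ∧
      (-(Complex.I • (weakPartial Ω 1 (φ 2) - (Complex.I * ev) • φ 1))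
          - Complex.I • weakPartial Ω 0 α - (k : ℂ) • ψ 0 = 0 ∧
        -(Complex.I • ((Complex.I * ev) • φ 0 - weakPartial Ω 0 (φ 2)))
          - Complex.I • weakPartial Ω 1 α - (k : ℂ) • ψ 1 = 0 ∧
        -(Complex.I • (weakPartial Ω 0 (φ 1) - weakPartial Ω 1 (φ 0)))
          - Complex.I • (Complex.I * ev) • α - (k : ℂ) • ψ 2 = 0) ∧
      Complex.I • (weakPartial Ω 0 (φ 0) + weakPartial Ω 1 (φ 1) + (Complex.I * ev) • φ 2)
          - (k : ℂ) • β = 0 := by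
  have hdiv (χ : Fin 3 → L2 Ω) : pencilDiv Ω ev χ
      = weakPartial Ω 0 (χ 0) + weakPartial Ω 1 (χ 1) + (Complex.I * ev) • χ 2 :=
    Fin.sum_univ_three _
  have hfun (χ : Fin 3 → L2 Ω) : χ = 0 ↔ χ 0 = 0 ∧ χ 1 = 0 ∧ χ 2 = 0 := by
    simp [funext_iff, Fin.forall_fin_succ]
  simp only [pencilFun, Prod.mk_eq_zero, hdiv]
  rw [hfun, hfun]
  rfl

/-- On constants only multiplication by `i ev` survives, and it enters just two components: the
divergence of `ψ` gives `h1`, the third component of `∇α` gives `h2`. -/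
lemma pencilFun_constVec (Ω : PlanarDomain) {k : ℝ} {ev a b : ℂ} (h1 : ev * b = k * a)
    (h2 : ev * a = k * b) : pencilFun Ω k ev (constVec Ω a b) = 0 := by
  have c1 : ev • const Ω b = (k : ℂ) • const Ω a := by
    rw [← const_smul_eq, ← const_smul_eq, h1]
  have c2 : ev • const Ω a = (k : ℂ) • const Ω b := by
    rw [← const_smul_eq, ← const_smul_eq, h2]
  have hI := Complex.I_mul_I
  refine pencilFun_eq_zero_iff.mpr ⟨⟨?_, ?_, ?_⟩, ?_, ⟨?_, ?_, ?_⟩, ?_⟩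
  · simp [weakPartial_const, weakPartial_zero]
  · simp [weakPartial_const, weakPartial_zero]
  · simp [weakPartial_zero]
  · simp only [Matrix.cons_val, weakPartial_zero, add_zero, zero_add]
    linear_combination (norm := module) c1 - hI • (ev • const Ω b)
  · simp [weakPartial_const, weakPartial_zero]
  · simp [weakPartial_const, weakPartial_zero]
  · simp only [Matrix.cons_val, Pi.zero_apply, weakPartial_zero, sub_zero, smul_zero, neg_zero]
    linear_combination (norm := module) c2 - hI • (ev • const Ω a)
  · simp [weakPartial_zero]

lemma mem_eigenspaceA {Ω : PlanarDomain} {l : ℕ+} {k : ℝ} {ev : ℂ} {Φ : Field8 Ω} :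
    Φ ∈ eigenspaceA Ω l k ev ↔ Φ ∈ DH Ω l ∧ pencilFun Ω k ev Φ = 0 := by
  constructor
  · rintro ⟨⟨Ψ, hΨ⟩, h, rfl⟩
    exact ⟨hΨ, h⟩
  · rintro ⟨h1, h2⟩
    exact ⟨⟨Φ, h1⟩, h2, rfl⟩

/-- For `ev = ± k`, the eigenvectors are the constant vectors that satisfy the equations. -/
theorem mem_eigenspaceA_iff {Ω : PlanarDomain} (hΩ : SimplyConnectedSpace Ω.carrier) {l : ℕ+}
    {k : ℝ} {s : ℂ} (hs : s * s = 1) {Φ : Field8 Ω} :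
    Φ ∈ eigenspaceA Ω l k (s * k) ↔ ∃ a b : ℂ, Φ = constVec Ω a b ∧ (k : ℂ) * (a - s * b) = 0 := by
  rw [mem_eigenspaceA]
  constructor
  · obtain ⟨φ, α, ψ, β⟩ := Φ
    rintro ⟨⟨hφ, hα, hψ, hβ, hφτ, hψν, hβ0⟩, h⟩
    simp only at hφ hα hψ hβ hφτ hψν hβ0
    obtain ⟨⟨A0, A1, A2⟩, B, ⟨C0, C1, C2⟩, D⟩ := pencilFun_eq_zero_iff.mp h
    have hI := Complex.I_mul_I
    -- Multiplying each component by `± i` clears the leading factor and gives `K = i k`. In the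
    -- last four equations `s * s = 1` allows `K * s` to be factored out.
    obtain ⟨hφz, ⟨a, ha⟩, ⟨b, hb⟩, hβz, hK⟩ := field_eq_const hΩ hφ hα hψ hβ hφτ hψν hβ0
      (K := Complex.I * k) hs
      (by linear_combination (norm := module) (-Complex.I) • A0
            + hI • (weakPartial Ω 1 (ψ 2) + weakPartial Ω 0 β - (Complex.I * (s * k)) • ψ 1))
      (by linear_combination (norm := module) (-Complex.I) • A1
            + hI • (-weakPartial Ω 0 (ψ 2) + weakPartial Ω 1 β + (Complex.I * (s * k)) • ψ 0))
      (by linear_combination (norm := module) (-Complex.I) • A2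
            + hI • (weakPartial Ω 0 (ψ 1) - weakPartial Ω 1 (ψ 0) + (Complex.I * (s * k)) • β))
      (by linear_combination (norm := module) Complex.I • B
            + hI • (weakPartial Ω 0 (ψ 0) + weakPartial Ω 1 (ψ 1) + (Complex.I * (s * k)) • ψ 2))
      (by linear_combination (norm := module) Complex.I • C0 - hs • ((Complex.I * k) • ψ 0)
            + hI • (weakPartial Ω 1 (φ 2) + weakPartial Ω 0 α - (Complex.I * (s * k)) • φ 1))
      (by linear_combination (norm := module) Complex.I • C1 - hs • ((Complex.I * k) • ψ 1)
            + hI • (-weakPartial Ω 0 (φ 2) + weakPartial Ω 1 α + (Complex.I * (s * k)) • φ 0))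
      (by linear_combination (norm := module) Complex.I • C2 - hs • ((Complex.I * k) • ψ 2)
            + hI • (weakPartial Ω 0 (φ 1) - weakPartial Ω 1 (φ 0) + (Complex.I * (s * k)) • α))
      (by linear_combination (norm := module) (-Complex.I) • D + hs • ((Complex.I * k) • β)
            + hI • (weakPartial Ω 0 (φ 0) + weakPartial Ω 1 (φ 1) + (Complex.I * (s * k)) • φ 2))
    refine ⟨a, b, by rw [hφz, ha, hb, hβz]; rfl, ?_⟩
    have hab : const Ω (Complex.I * (k * (a - s * b))) = 0 := by
      rw [← hK, ha, hb]
      simp only [Matrix.cons_val]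
      rw [← mul_assoc, const_smul_eq, const_sub, const_smul_eq]
    simpa using const_eq_zero_iff.mp hab
  · rintro ⟨a, b, rfl, h⟩
    refine ⟨constVec_mem_DH Ω l a b, pencilFun_constVec Ω ?_ ?_⟩
    · linear_combination -h
    · linear_combination s * h + k * b * hs

lemma constVec_eq_zero_iff {Ω : PlanarDomain} {a b : ℂ} : constVec Ω a b = 0 ↔ a = 0 ∧ b = 0 := by
  constructor
  · intro h
    refine ⟨const_eq_zero_iff.mp (congrArg (fun Φ : Field8 Ω => Φ.2.1) h),
      const_eq_zero_iff.mp (congrArg (fun Φ : Field8 Ω => Φ.2.2.1 2) h)⟩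
  · rintro ⟨rfl, rfl⟩
    refine Prod.ext rfl (Prod.ext (const_zero Ω) (Prod.ext ?_ rfl))
    funext i
    fin_cases i
    · rfl
    · rfl
    · exact const_zero Ω

lemma smul_constVec (Ω : PlanarDomain) (t a b : ℂ) :
    t • constVec Ω a b = constVec Ω (t * a) (t * b) := by
  refine Prod.ext (smul_zero t) (Prod.ext (const_smul_eq Ω t a).symm (Prod.ext ?_ (smul_zero t)))
  funext i
  fin_cases i
  · exact smul_zero t
  · exact smul_zero t
  · exact (const_smul_eq Ω t b).symm

lemma constVec_add (Ω : PlanarDomain) (a b : ℂ) :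
    constVec Ω a 0 + constVec Ω 0 b = constVec Ω a b := by
  refine Prod.ext (add_zero 0) (Prod.ext ?_ (Prod.ext ?_ (add_zero 0)))
  · change const Ω a + const Ω 0 = const Ω a
    rw [const_zero, add_zero]
  · funext i
    fin_cases i
    · exact add_zero 0
    · exact add_zero 0
    · change const Ω 0 + const Ω b = const Ω b
      rw [const_zero, zero_add]

lemma constVec_mem_domainM_iff {Ω : PlanarDomain} {l : ℕ+} {a b : ℂ} :
    constVec Ω a b ∈ domainM Ω l ↔ a = 0 :=
  ⟨fun h => const_eq_zero_iff.mp h.2.1,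
    fun h => ⟨constVec_mem_DH Ω l a b, const_eq_zero_iff.mpr h, rfl⟩⟩

lemma isEigenvalue_pencilA {Ω : PlanarDomain} {l : ℕ+} {k : ℝ} {ev : ℂ} {Φ : Field8 Ω}
    (h : Φ ∈ eigenspaceA Ω l k ev) (h0 : Φ ≠ 0) : IsEigenvalue (pencilA Ω l k) ev := by
  obtain ⟨h1, h2⟩ := mem_eigenspaceA.mp h
  exact ⟨⟨Φ, h1⟩, fun h' => h0 (congrArg Subtype.val h'), h2⟩

/-- For `k ≠ 0` the surviving condition is `a = s * b`, that is `b = s * a`, which leaves one free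
constant. -/
lemma eigenspaceA_eq_span_singleton {Ω : PlanarDomain} (hΩ : SimplyConnectedSpace Ω.carrier)
    (l : ℕ+) {k : ℝ} (hk : (k : ℂ) ≠ 0) {s : ℂ} (hs : s * s = 1) {c : ℂ} (hc : c ≠ 0) :
    eigenspaceA Ω l k (s * k) = Submodule.span ℂ {constVec Ω c (s * c)} := by
  ext Φ
  rw [mem_eigenspaceA_iff hΩ hs, Submodule.mem_span_singleton]
  constructor
  · rintro ⟨a, b, rfl, h⟩
    have hab : a = s * b := sub_eq_zero.mp ((mul_eq_zero.mp h).resolve_left hk)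
    refine ⟨a / c, ?_⟩
    rw [smul_constVec, div_mul_cancel₀ _ hc]
    congr 1
    rw [mul_left_comm, div_mul_cancel₀ _ hc, hab]
    linear_combination b * hs
  · rintro ⟨t, rfl⟩
    refine ⟨t * c, t * (s * c), smul_constVec Ω t c (s * c), ?_⟩
    linear_combination (-(k : ℂ) * t * c) * hs

/-- For `k = 0` the condition on the constants is empty; the sign `s` is immaterial and is taken to
be `1`. -/
lemma eigenspaceA_zero_eq_span_pair {Ω : PlanarDomain} (hΩ : SimplyConnectedSpace Ω.carrier)
    (l : ℕ+) {a b : ℂ} (ha : a ≠ 0) (hb : b ≠ 0) :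
    eigenspaceA Ω l 0 0 = Submodule.span ℂ {constVec Ω a 0, constVec Ω 0 b} := by
  ext Φ
  have hmem := mem_eigenspaceA_iff hΩ (l := l) (k := 0) (s := 1) (one_mul 1) (Φ := Φ)
  simp only [Complex.ofReal_zero, mul_zero, zero_mul, and_true] at hmem
  rw [hmem, Submodule.mem_span_pair]
  have hcomb (x y : ℂ) :
      x • constVec Ω a 0 + y • constVec Ω 0 b = constVec Ω (x * a) (y * b) := by
    rw [smul_constVec, smul_constVec, mul_zero, mul_zero, constVec_add]
  constructor
  · rintro ⟨x, y, rfl⟩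
    exact ⟨x / a, y / b, by rw [hcomb, div_mul_cancel₀ _ ha, div_mul_cancel₀ _ hb]⟩
  · rintro ⟨x, y, rfl⟩
    exact ⟨x * a, y * b, hcomb x y⟩

lemma finrank_eigenspaceA_zero {Ω : PlanarDomain} (hΩ : SimplyConnectedSpace Ω.carrier)
    (l : ℕ+) : Module.finrank ℂ (eigenspaceA Ω l 0 0) = 2 := by
  have hli : LinearIndependent ℂ ![constVec Ω 1 0, constVec Ω 0 1] := by
    rw [LinearIndependent.pair_iff]
    intro x y h
    rw [smul_constVec, smul_constVec, mul_zero, mul_zero, constVec_add,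
      constVec_eq_zero_iff] at h
    simpa using h
  have h := finrank_span_eq_card hli
  rw [Matrix.range_cons, Matrix.range_cons, Matrix.range_empty, Set.union_empty,
    Set.singleton_union] at h
  rw [eigenspaceA_zero_eq_span_pair hΩ l one_ne_zero one_ne_zero, h, Fintype.card_fin]

end Waveguide

end

theorem proposition2p2 (Ω : Waveguide.PlanarDomain) (hΩ : SimplyConnectedSpace Ω.carrier)
    (l : ℕ+) (k : ℝ) :
    (∀ ev : ℂ, ev ^ 2 = (k : ℂ) ^ 2 → k ≠ 0 →
      Waveguide.IsEigenvalue (Waveguide.pencilA Ω l k) ev ∧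
      Module.finrank ℂ (Waveguide.eigenspaceA Ω l k ev) = 1 ∧
      (∀ c : ℂ, c ≠ 0 →
        Waveguide.eigenspaceA Ω l k ev
            = Submodule.span ℂ {Waveguide.constVec Ω c (ev / (k : ℂ) * c)} ∧
        Waveguide.constVec Ω c (ev / (k : ℂ) * c) ∉ Waveguide.domainM Ω l) ∧
      ¬ Waveguide.IsEigenvalue (Waveguide.pencilM Ω l k) ev) ∧
    (k = 0 →
      Waveguide.IsEigenvalue (Waveguide.pencilA Ω l k) 0 ∧
      Module.finrank ℂ (Waveguide.eigenspaceA Ω l k 0) = 2 ∧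
      ∀ a b : ℂ, a ≠ 0 → b ≠ 0 →
        Waveguide.eigenspaceA Ω l k 0
            = Submodule.span ℂ {Waveguide.constVec Ω a 0, Waveguide.constVec Ω 0 b} ∧
        Waveguide.constVec Ω a 0 ∉ Waveguide.domainM Ω l ∧
        ∃ h : Waveguide.constVec Ω 0 b ∈ Waveguide.domainM Ω l,
          Waveguide.constVec Ω 0 b ≠ 0 ∧
          Waveguide.pencilM Ω l k 0 ⟨Waveguide.constVec Ω 0 b, h⟩ = 0) := by
  refine ⟨fun ev hev hk => ?_, ?_⟩
  · have hk' : (k : ℂ) ≠ 0 := Complex.ofReal_ne_zero.mpr hk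
    -- The quotient `ev / k` plays the role of the sign `s`, so both roots are treated at once.
    have hs : ev / k * (ev / k) = 1 := by
      rw [div_mul_div_comm, ← sq, ← sq, hev, div_self (pow_ne_zero 2 hk')]
    have hev' : ev / k * k = ev := div_mul_cancel₀ ev hk'
    have hspan (c : ℂ) (hc : c ≠ 0) := Waveguide.eigenspaceA_eq_span_singleton hΩ l hk' hs hc
    rw [hev'] at hspan
    have hne : Waveguide.constVec Ω 1 (ev / k * 1) ≠ 0 := fun h =>
      one_ne_zero (Waveguide.constVec_eq_zero_iff.mp h).1
    refine ⟨?_, ?_, fun c hc => ⟨hspan c hc, fun h =>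
      hc (Waveguide.constVec_mem_domainM_iff.mp h)⟩, ?_⟩
    · refine Waveguide.isEigenvalue_pencilA (Φ := Waveguide.constVec Ω 1 (ev / k * 1)) ?_ hne
      rw [hspan 1 one_ne_zero]
      exact Submodule.mem_span_singleton_self _
    · rw [hspan 1 one_ne_zero, finrank_span_singleton hne]
    -- An eigenvector of the Maxwell pencil would be `t` times the spanning vector; its `α`
    -- component is the constant `t`, which the domain forces to be zero.
    · rintro ⟨⟨Φ, hΦ⟩, hne0, h⟩
      have hmem : Φ ∈ Waveguide.eigenspaceA Ω l k ev := Waveguide.mem_eigenspaceA.mpr ⟨hΦ.1, h⟩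
      rw [hspan 1 one_ne_zero, Submodule.mem_span_singleton] at hmem
      obtain ⟨t, rfl⟩ := hmem
      refine hne0 (Subtype.ext ?_)
      change t • Waveguide.constVec Ω 1 (ev / k * 1) = 0
      rw [Waveguide.smul_constVec, Waveguide.constVec_mem_domainM_iff, mul_one] at hΦ
      rw [hΦ, zero_smul]
  · rintro rfl
    have hspan {a b : ℂ} (ha : a ≠ 0) (hb : b ≠ 0) :=
      Waveguide.eigenspaceA_zero_eq_span_pair hΩ l ha hb
    refine ⟨?_, Waveguide.finrank_eigenspaceA_zero hΩ l, fun a b ha hb => ⟨hspan ha hb,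
      fun h => ha (Waveguide.constVec_mem_domainM_iff.mp h),
      Waveguide.constVec_mem_domainM_iff.mpr rfl,
      fun h => hb (Waveguide.constVec_eq_zero_iff.mp h).2,
      Waveguide.pencilFun_constVec Ω (by simp) (by simp)⟩⟩
    refine Waveguide.isEigenvalue_pencilA (Φ := Waveguide.constVec Ω 1 0) ?_ fun h =>
      one_ne_zero (Waveguide.constVec_eq_zero_iff.mp h).1
    rw [hspan one_ne_zero one_ne_zero]
    exact Submodule.subset_span (Set.mem_insert _ _)
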